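/- Let $p(y|x)$ be a discrete memoryless channel with finite (nonempty, linearly ordered) input alphabet and finite output alphabet, without redundant input symbols: no two distinct inputs $x_1\ne x_2$ satisfy $p(y|x_1)=p(y|x_2)$ for all $y$. Let $p(x)$ be an input pmf that is not a point mass, with cdf $F_X$; put $p(y)=\sum_x p(x)p(y|x)$, $p_{Y|W}(y|w)=p(y|F_X^{-1}(w))$ and $F_{W|Y}(dw|y)=p_{Y|W}(y|w)\,dw/\int_0^1 p_{Y|W}(y|w')\,dw'$ on $[0,1]$. Scheme (block length $n$, rate $R$, noiseless feedback). The message $M$ is uniform on $\{1,\dots,N\}$, $N=\lceil e^{nR}\rceil$; the shifts $U_1,\dots,U_n$ are i.i.d. uniform on $[0,1)$, independent of $M$ and known to both sides. Put $s_0(m)=1/N$, $t_i(m)=\sum_{m'<m}s_i(m')$, and, after $Y_i=y_i$ is received, $s_i(m)=\int_{[t_{i-1}(m),\,t_{i-1}(m)+s_{i-1}(m)]+U_i \bmod 1}F_{W|Y}(dw|y_i)$. At time $i$ the encoder sends $X_i=F_X^{-1}(W_i)$ with $W_i=V_i\,s_{i-1}(M)+t_{i-1}(M)+U_i \bmod 1$,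 where $V_i\in[0,1]$ maximizes over $v$ the conditional expectation of $\ln s_i(M)$, given the past and $U_i$, when $v$ is used for $V_i$ (maximal information gain; ties are broken by any measurable rule that depends only on $s_{i-1}(M)$ and $t_{i-1}(M)+U_i \bmod 1$; such a rule exists). The decoder outputs the $m$ with the largest $s_n(m)$. Let $P_e^{(n)}(R)$ be the error probability (a tie for the largest value counts as an error) and $E(R)=\limsup_{n\to\infty}-\frac1n\ln P_e^{(n)}(R)\in[0,\infty]$. With $S_i=s_i(M)$ define $$\phi(\rho)=\sum_x p(x)\sum_y p(y|x)\Bigl(\frac{p(y|x)}{p(y)}\Bigr)^{-\rho},\qquad \psi_s(\rho)=\mathbb E\bigl[S_i^{-\rho}/S_{i-1}^{-\rho}\,\big|\,S_{i-1}=s\bigr],\qquad \Psi=\inf_{\tau}\sup_{s\in(0,1)}\psi_s(\tau(s)),$$ the infimum being over all nondecreasing $\tau:(0,1)\to[0,\infty)$; here $\psi_s$ is the one-step transition of the scheme, in which $t_{i-1}(M)+U_i\bmod 1$ is uniform on $[0,1)$. Then $\Psi<1$, and for every $R<I(X;Y)$ we have $P_e^{(n)}(R)\to0$ and $$E(R)\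 \ge\ \sup_{\rho>0}\bigl\{-\rho R-\ln\max(\phi(\rho),\Psi)\bigr\}.$$ Moreover the scheme achieves the capacity $C=\max_{p(x)}I(X;Y)$: there is an input pmf with $I(X;Y)=C$ (possibly a point mass, if $C=0$) such that, with it and any such selection rule, $P_e^{(n)}(R)\to0$ for every $R<C$. -/

import Mathlib

open MeasureTheory Set Filter Topology
open scoped ENNReal BigOperators

noncomputable section

namespace FeedbackScheme

section Channel

variable {𝒳 𝒴 : Type*} [Fintype 𝒳] [Fintype 𝒴]

/-- `p x y` is the probability `p(y|x)` of receiving `y` when `x` is sent: every row of the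
transition matrix is a probability mass function. -/
def IsChannel (p : 𝒳 → 𝒴 → ℝ) : Prop := ∀ x, p x ∈ stdSimplex ℝ 𝒴

/-- No two distinct input symbols have the same output distribution. -/
def NoRedundantInputs (p : 𝒳 → 𝒴 → ℝ) : Prop :=
  ∀ x₁ x₂, x₁ ≠ x₂ → ¬ ∀ y, p x₁ y = p x₂ y

/-- Output pmf `p(y) = ∑ₓ p(x) p(y|x)` for the input pmf `q`. -/
def outputPMF (p : 𝒳 → 𝒴 → ℝ) (q : 𝒳 → ℝ) (y : 𝒴) : ℝ := ∑ x, q x * p x y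

/-- Mutual information `I(X;Y)` in nats, for the input pmf `q` (`0 ln 0 = 0`). -/
def mutualInfo (p : 𝒳 → 𝒴 → ℝ) (q : 𝒳 → ℝ) : ℝ :=
  ∑ x, ∑ y, q x * p x y * Real.log (p x y / outputPMF p q y)

/-- Capacity: the supremum of `I(X;Y)` over all input pmfs. -/
def capacity (p : 𝒳 → 𝒴 → ℝ) : ℝ := ⨆ q : stdSimplex ℝ 𝒳, mutualInfo p q

/-- Ideal moment generating function
`φ(ρ) = ∑ₓ p(x) ∑_y p(y|x) (p(y|x) / p(y)) ^ (-ρ)`.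
(Terms with `p(x) p(y|x) = 0` vanish.) -/
def idealMGF (p : 𝒳 → 𝒴 → ℝ) (q : 𝒳 → ℝ) (ρ : ℝ) : ℝ :=
  ∑ x, q x * ∑ y, p x y * (p x y / outputPMF p q y) ^ (-ρ)

end Channel

section Scheme

variable {𝒳 𝒴 : Type*} [Fintype 𝒳] [LinearOrder 𝒳] [Nonempty 𝒳] [Fintype 𝒴]

/-- Cumulative distribution function of the input pmf `q`. -/
def cdf (q : 𝒳 → ℝ) (x : 𝒳) : ℝ := ∑ x' with x' ≤ x, q x'

/-- The inverse cdf `F_X⁻¹(w)`, for `0 ≤ w ≤ 1`. For `0 < w ≤ 1` this is the symbol `x` with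
`F_X(x-1) < w ≤ F_X(x)`, and `w = 0` is sent to the first symbol of positive probability.
(The default value is never reached when `q` is a pmf and `w ≤ 1`.) -/
def quantile (q : 𝒳 → ℝ) (w : ℝ) : 𝒳 :=
  if h : ({x | 0 < q x ∧ w ≤ cdf q x} : Finset 𝒳).Nonempty then Finset.min' _ h
  else Classical.arbitrary 𝒳

/-- Density of `W` given `Y = y`: `p(y|w) / ∫₀¹ p(y|w') dw'` with `p(y|w) = p(y|F_X⁻¹(w))`. -/
def condDensity (p : 𝒳 → 𝒴 → ℝ) (q : 𝒳 → ℝ) (y : 𝒴) (w : ℝ) : ℝ :=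
  p (quantile q w) y / ∫ w' in (0 : ℝ)..1, p (quantile q w') y

/-- The conditional probability, given `Y = y`, of the arc `[a, a + s] mod 1`, that is
`∫_{[a, a+s] mod 1} dF_{W|Y}(w|y)`. Since `0 ≤ s ≤ 1`, the arc is covered once as `z` runs
through `[a, a + s]`. -/
def arcMass (p : 𝒳 → 𝒴 → ℝ) (q : 𝒳 → ℝ) (y : 𝒴) (s a : ℝ) : ℝ :=
  ∫ z in a..(a + s), condDensity p q y (Int.fract z)

/-- The input symbol `F_X⁻¹(w)` for the point `w = v s + a mod 1` of the arc of length `s`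
starting at `a`. -/
def inputAt (q : 𝒳 → ℝ) (s a v : ℝ) : 𝒳 := quantile q (Int.fract (v * s + a))

/-- `E[ln S']`, where `S'` is the length to which a message interval placed at `[a, a+s] mod 1`
is updated when the symbol `x` is sent. It is `-∞` if `S' = 0` has positive probability. -/
def expLogLength (p : 𝒳 → 𝒴 → ℝ) (q : 𝒳 → ℝ) (s a : ℝ) (x : 𝒳) : EReal :=
  ∑ y, (p x y : EReal) * ENNReal.log (ENNReal.ofReal (arcMass p q y s a))

/-- `V` is a maximal information gain rule: `V s a ∈ [0,1]` attains
`argmax_v E[ln S' | W = v s + a mod 1]` for the message interval `[a, a+s] mod 1`.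
Ties may be broken in any measurable way. -/
structure IsMaxInfoGainRule (p : 𝒳 → 𝒴 → ℝ) (q : 𝒳 → ℝ) (V : ℝ → ℝ → ℝ) : Prop where
  measurable : Measurable (Function.uncurry V)
  mem : ∀ s ∈ Ioc (0 : ℝ) 1, ∀ a ∈ Ico (0 : ℝ) 1, V s a ∈ Icc (0 : ℝ) 1
  isMax : ∀ s ∈ Ioc (0 : ℝ) 1, ∀ a ∈ Ico (0 : ℝ) 1,
    IsMaxOn (fun v => expLogLength p q s a (inputAt q s a v)) (Icc (0 : ℝ) 1) (V s a)

/-- Left end point `t(m) = ∑_{m' < m} s(m')` of the interval of message `m`. -/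
def leftEnd {N : ℕ} (s : Fin N → ℝ) (m : Fin N) : ℝ := ∑ m' with m' < m, s m'

/-- The interval lengths (pseudo posterior probabilities) `s_n(m, yⁿ, uⁿ)` of the `N` messages,
given the received symbols `yⁿ` and the cyclic shifts `uⁿ`. -/
def len (p : 𝒳 → 𝒴 → ℝ) (q : 𝒳 → ℝ) (N : ℕ) :
    (n : ℕ) → (Fin n → 𝒴) → (Fin n → ℝ) → Fin N → ℝ
  | 0, _, _ => fun _ => (N : ℝ)⁻¹
  | n + 1, y, u => fun m =>
      arcMass p q (y (Fin.last n)) (len p q N n (Fin.init y) (Fin.init u) m)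
        (leftEnd (len p q N n (Fin.init y) (Fin.init u)) m + u (Fin.last n))

/-- The symbol sent for message `m` when the current interval lengths are `s` and the current
cyclic shift is `u`. -/
def encode (q : 𝒳 → ℝ) (V : ℝ → ℝ → ℝ) {N : ℕ} (s : Fin N → ℝ) (m : Fin N) (u : ℝ) : 𝒳 :=
  inputAt q (s m) (Int.fract (leftEnd s m + u))
    (V (s m) (Int.fract (leftEnd s m + u)))

/-- Conditional probability of receiving `yⁿ` given that message `m` is sent and that the cyclic
shifts are `uⁿ`: the product of `p(y_i | x_i)` with `x_i` determined by `m, y^{i-1}, u^i`. -/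
def outputProb (p : 𝒳 → 𝒴 → ℝ) (q : 𝒳 → ℝ) (V : ℝ → ℝ → ℝ) {N : ℕ} (m : Fin N) :
    (n : ℕ) → (Fin n → 𝒴) → (Fin n → ℝ) → ℝ
  | 0, _, _ => 1
  | n + 1, y, u => outputProb p q V m n (Fin.init y) (Fin.init u) *
      p (encode q V (len p q N n (Fin.init y) (Fin.init u)) m (u (Fin.last n)))
        (y (Fin.last n))

/-- Number of messages at block length `n` and rate `R`: `⌈e^{nR}⌉`. -/
def numMessages (n : ℕ) (R : ℝ) : ℕ := ⌈Real.exp (n * R)⌉₊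

open Classical in
/-- Error probability with `N` equiprobable messages and `n` channel uses, the shifts being
i.i.d. uniform on `[0,1)`. The decoder outputs a message with the longest interval; a tie for the
longest interval is counted as an error, which is the worst case over all tie-breaking rules. -/
def errorProb (p : 𝒳 → 𝒴 → ℝ) (q : 𝒳 → ℝ) (V : ℝ → ℝ → ℝ) (N n : ℕ) : ℝ≥0∞ :=
  (N : ℝ≥0∞)⁻¹ * ∑ m : Fin N,
    ∫⁻ u, ∑ y : Fin n → 𝒴,
      (if ∃ m', m' ≠ m ∧ len p q N n y u m ≤ len p q N n y u m'
        then ENNReal.ofReal (outputProb p q V m n y u) else 0)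
      ∂(Measure.pi fun _ : Fin n => (volume : Measure ℝ).restrict (Ico 0 1))

/-- Error exponent `E(R) = limsup_n -n⁻¹ ln P_e^{(n)}(R)`, in the extended reals. -/
def errorExponent (p : 𝒳 → 𝒴 → ℝ) (q : 𝒳 → ℝ) (V : ℝ → ℝ → ℝ) (R : ℝ) : EReal :=
  limsup (fun n : ℕ => (((n : ℝ)⁻¹ : ℝ) : EReal) *
    (-ENNReal.log (errorProb p q V (numMessages n R) n))) atTop

/-- Actual moment generating function `ψ_s(ρ) = E[S_i^{-ρ} / S_{i-1}^{-ρ} | S_{i-1} = s]` of the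
interval length of the transmitted message. Given the past, the shifted interval starts at a point
`a` uniform on `[0,1)`, and `Y_i` has the law `p(·|x)` for the symbol `x` that the rule selects. -/
def actualMGF (p : 𝒳 → 𝒴 → ℝ) (q : 𝒳 → ℝ) (V : ℝ → ℝ → ℝ) (s ρ : ℝ) : ℝ≥0∞ :=
  ∫⁻ a in Ico (0 : ℝ) 1, ∑ y, ENNReal.ofReal (p (inputAt q s a (V s a)) y) *
    ENNReal.ofReal (arcMass p q y s a / s) ^ (-ρ)

/-- `Ψ = inf_τ sup_{0<s<1} ψ_s(τ(s))` over all nondecreasing `τ : (0,1) → [0,∞)`. -/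
def Psi (p : 𝒳 → 𝒴 → ℝ) (q : 𝒳 → ℝ) (V : ℝ → ℝ → ℝ) : ℝ≥0∞ :=
  ⨅ (τ : ℝ → ℝ) (_ : MonotoneOn τ (Ioo 0 1)) (_ : ∀ s ∈ Ioo (0 : ℝ) 1, 0 ≤ τ s),
    ⨆ s ∈ Ioo (0 : ℝ) 1, actualMGF p q V s (τ s)

end Scheme

end FeedbackScheme

end

/-! The proof is a supermartingale argument for one function of the length `s` of the transmitted
message's interval. For nondecreasing `θ` put `f(s) = exp ∫_s^{1/2} θ(t)/t dt`. As a function of `ln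
s`, `ln f` has slope `-θ(s)` and is concave, so it lies below its tangents: `f(s')/f(s) ≤
(s'/s)^(-θ(s))`. If all `ψ_s(θ(s)) ≤ K`, one channel use multiplies the expectation of `f` by at
most `K`, the random shift making the arc's starting point uniform whatever the past. An error
forces `S_n ≤ 1/2`, where `f ≥ 1`; hence `P_e ≤ K^n f(1/N)` (`expLen_le`, `errorProb_le`).

The exponent comes from choosing `θ`. Given `K > max(φ(ρ), Ψ)`, start from a nearly optimal `τ` for
`Ψ`. If it exceeds `ρ` everywhere, replace it by `ρ` near `0`; this is harmless because `ψ_s(ρ) →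
φ(ρ)` as `s → 0` (`tendsto_actualMGF`, `exists_monotone_exponent`). Then `f(s) = O(s^(-ρ))`, and
`P_e` is at most a constant times `K^n e^{nρR}`. Since `φ(0) = 1`, `φ'(0) = -I(X;Y)` and `Ψ < 1`,
some small `ρ` gives decay at every rate below `I(X;Y)`.

For `Ψ < 1` take `τ(s) = r/(1-s)`. The log increment is at most `B(1-s)` in absolute value
(`exists_abs_log_le`) and its mean is at least `c(1-s)` (`exists_integral_infoGain_ge`), so a
second-order expansion gives `ψ_s ≤ 1 - rc/2` for small `r`. The mean bound uses maximality: the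
best symbol gains at least the average over the arc, which is a relative entropy. That suffices away
from `s = 1`. Near `s = 1` the relative entropy is only of order `(1-s)²`; there a linear gain comes
from sending a symbol whose outputs make the missing piece of the circle unlikely. -/

noncomputable section

namespace FeedbackScheme

/-! ### The inverse cdf, with symbols of probability zero allowed -/

section Quantile

variable {𝒳 : Type*} [Fintype 𝒳] [LinearOrder 𝒳]

/-- Probability of the symbols strictly below `x`. -/
def cdfLT (q : 𝒳 → ℝ) (x : 𝒳) : ℝ := ∑ x' with x' < x, q x'

lemma cdf_eq_cdfLT_add (q : 𝒳 → ℝ) (x : 𝒳) : cdf q x = cdfLT q x + q x := by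
  have : (Finset.univ.filter (fun x' => x' ≤ x)) =
      insert x (Finset.univ.filter (fun x' => x' < x)) := by
    ext z; simp [le_iff_lt_or_eq, or_comm]
  rw [cdf, this, Finset.sum_insert (by simp), add_comm, cdfLT]

lemma cdfLT_nonneg {q : 𝒳 → ℝ} (hq : ∀ x, 0 ≤ q x) (x : 𝒳) : 0 ≤ cdfLT q x :=
  Finset.sum_nonneg fun z _ => hq z

lemma cdf_le_one {q : 𝒳 → ℝ} (hq : q ∈ stdSimplex ℝ 𝒳) (x : 𝒳) : cdf q x ≤ 1 := by
  rw [← hq.2]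
  exact Finset.sum_le_sum_of_subset_of_nonneg (Finset.filter_subset _ _) fun z _ _ => hq.1 z

lemma cdf_le_cdfLT {q : 𝒳 → ℝ} (hq : ∀ x, 0 ≤ q x) {x x' : 𝒳} (h : x < x') :
    cdf q x ≤ cdfLT q x' := by
  refine Finset.sum_le_sum_of_subset_of_nonneg ?_ fun z _ _ => hq z
  intro z hz
  simp only [Finset.mem_filter, Finset.mem_univ, true_and] at hz ⊢
  exact hz.trans_lt h

/-- Take the last symbol of positive probability before `x`; those in between carry no mass. -/
lemma exists_cdf_eq_cdfLT {q : 𝒳 → ℝ} (hq : ∀ x, 0 ≤ q x) {x : 𝒳} (h : 0 < cdfLT q x) :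
    ∃ x' < x, 0 < q x' ∧ cdf q x' = cdfLT q x := by
  set T : Finset 𝒳 := {x' | x' < x ∧ 0 < q x'} with hT
  have hne : T.Nonempty := by
    obtain ⟨z, hz, hz0⟩ := Finset.exists_lt_of_sum_lt (s := Finset.univ.filter (fun x' => x' < x))
      (f := fun _ => (0 : ℝ)) (g := q) (by simpa [cdfLT] using h)
    exact ⟨z, by simp only [hT, Finset.mem_filter, Finset.mem_univ, true_and] at hz ⊢; exact ⟨hz, hz0⟩⟩
  have hm := Finset.max'_mem T hne
  have hm' := hm
  simp only [hT, Finset.mem_filter, Finset.mem_univ, true_and] at hm'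
  refine ⟨T.max' hne, hm'.1, hm'.2, ?_⟩
  refine Finset.sum_subset ?_ ?_
  · intro z hz
    simp only [Finset.mem_filter, Finset.mem_univ, true_and] at hz ⊢
    exact hz.trans_lt hm'.1
  · intro z hz hz'
    simp only [Finset.mem_filter, Finset.mem_univ, true_and, not_le] at hz hz'
    by_contra hne0
    have : z ∈ T := by
      simp only [hT, Finset.mem_filter, Finset.mem_univ, true_and]
      exact ⟨hz, lt_of_le_of_ne (hq z) (Ne.symm hne0)⟩
    exact absurd (Finset.le_max' T z this) (not_le.mpr hz')

lemma exists_le_cdf {q : 𝒳 → ℝ} (hq : q ∈ stdSimplex ℝ 𝒳) {w : ℝ} (hw : w ≤ 1) :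
    ∃ x, 0 < q x ∧ w ≤ cdf q x := by
  set T : Finset 𝒳 := {x' | 0 < q x'} with hT
  have hne : T.Nonempty := by
    obtain ⟨z, hz, hz0⟩ := Finset.exists_lt_of_sum_lt (s := Finset.univ)
      (f := fun _ => (0 : ℝ)) (g := q) (by simp [hq.2])
    exact ⟨z, by simpa [hT] using hz0⟩
  have hm := Finset.max'_mem T hne
  simp only [hT, Finset.mem_filter, Finset.mem_univ, true_and] at hm
  refine ⟨T.max' hne, hm, hw.trans_eq ?_⟩
  rw [← hq.2]
  symm
  refine Finset.sum_subset (Finset.filter_subset _ _) ?_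
  intro z _ hz'
  simp only [Finset.mem_filter, Finset.mem_univ, true_and, not_le] at hz'
  by_contra hne0
  have : z ∈ T := by
    simp only [hT, Finset.mem_filter, Finset.mem_univ, true_and]
    exact lt_of_le_of_ne (hq.1 z) (Ne.symm hne0)
  exact absurd (Finset.le_max' T z this) (not_le.mpr hz')

lemma exists_cdfLT_le_lt_cdf {q : 𝒳 → ℝ} (hq : q ∈ stdSimplex ℝ 𝒳) {b : ℝ} (hb : b ∈ Ico (0 : ℝ) 1) :
    ∃ x, cdfLT q x ≤ b ∧ b < cdf q x := by
  set T : Finset 𝒳 := {x | b < cdf q x} with hT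
  have hne : T.Nonempty := by
    obtain ⟨x, _, hx⟩ := exists_le_cdf hq le_rfl
    exact ⟨x, by simpa [hT] using hb.2.trans_le hx⟩
  have hm := Finset.min'_mem T hne
  simp only [hT, Finset.mem_filter, Finset.mem_univ, true_and] at hm
  refine ⟨T.min' hne, ?_, hm⟩
  by_contra! hlt
  obtain ⟨x', hx', hpos, heq⟩ := exists_cdf_eq_cdfLT hq.1 (hb.1.trans_lt hlt)
  have : x' ∈ T := by
    simp only [hT, Finset.mem_filter, Finset.mem_univ, true_and]
    rw [heq]; exact hlt
  exact absurd (Finset.min'_le T x' this) (not_le.mpr hx')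

variable [Nonempty 𝒳]

lemma quantile_spec {q : 𝒳 → ℝ} (hq : q ∈ stdSimplex ℝ 𝒳) {w : ℝ} (hw : w ≤ 1) :
    0 < q (quantile q w) ∧ w ≤ cdf q (quantile q w) := by
  have h : ({x | 0 < q x ∧ w ≤ cdf q x} : Finset 𝒳).Nonempty := by
    obtain ⟨x, hx⟩ := exists_le_cdf hq hw
    exact ⟨x, by simpa using hx⟩
  rw [quantile, dif_pos h]
  simpa using Finset.min'_mem _ h

lemma quantile_le {q : 𝒳 → ℝ} {w : ℝ} {x : 𝒳} (hx : 0 < q x)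
    (hwx : w ≤ cdf q x) : quantile q w ≤ x := by
  have hm : x ∈ ({x | 0 < q x ∧ w ≤ cdf q x} : Finset 𝒳) := by simp [hx, hwx]
  rw [quantile, dif_pos ⟨x, hm⟩]
  exact Finset.min'_le _ _ hm

lemma quantile_eq_iff {q : 𝒳 → ℝ} (hq : q ∈ stdSimplex ℝ 𝒳) {w : ℝ} (hw : w ∈ Ioc (0 : ℝ) 1)
    {x : 𝒳} : quantile q w = x ↔ w ∈ Ioc (cdfLT q x) (cdf q x) := by
  constructor
  · rintro rfl
    refine ⟨?_, (quantile_spec hq hw.2).2⟩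
    by_contra! hlt
    obtain ⟨x', hx', hpos, heq⟩ := exists_cdf_eq_cdfLT hq.1 (hw.1.trans_le hlt)
    exact absurd (quantile_le hpos (hlt.trans_eq heq.symm)) (not_le.mpr hx')
  · rintro ⟨h1, h2⟩
    have hx : 0 < q x := by rw [cdf_eq_cdfLT_add] at h2; linarith
    refine le_antisymm (quantile_le hx h2) ?_
    by_contra! hlt
    have := cdf_le_cdfLT hq.1 hlt
    linarith [(quantile_spec hq hw.2).2]

/-- The symbol intervals are open on the left, so the point `0` belongs to none of them and needs
this separate statement. -/
lemma quantile_eq_quantile_zero {q : 𝒳 → ℝ} (hq : q ∈ stdSimplex ℝ 𝒳) {w : ℝ}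
    (hw : w ∈ Icc (0 : ℝ) (q (quantile q 0))) : quantile q w = quantile q 0 := by
  rcases hw.1.eq_or_lt with rfl | h0
  · rfl
  have h1 : cdfLT q (quantile q 0) ≤ 0 := by
    by_contra! hlt
    obtain ⟨x', hx', hpos, heq⟩ := exists_cdf_eq_cdfLT hq.1 hlt
    exact absurd (quantile_le hpos (heq ▸ hlt.le)) (not_le.mpr hx')
  have h2 := cdf_eq_cdfLT_add q (quantile q 0)
  have h3 := cdfLT_nonneg hq.1 (quantile q 0)
  have h4 := cdf_le_one hq (quantile q 0)
  rw [quantile_eq_iff hq ⟨h0, by linarith [hw.2]⟩]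
  exact ⟨by linarith, by linarith [hw.2]⟩

/-- The set of candidate symbols is a measurable function of `w` with finitely many values.
Composing with `h` avoids choosing a σ-algebra on the alphabet. -/
lemma measurable_comp_quantile {β : Type*} [MeasurableSpace β] (q : 𝒳 → ℝ) (h : 𝒳 → β) :
    Measurable fun w => h (quantile q w) := by
  classical
  let _ : MeasurableSpace (Finset 𝒳) := ⊤
  let F : ℝ → Finset 𝒳 := fun w => {x | 0 < q x ∧ w ≤ cdf q x}
  have hF : Measurable F := by
    refine measurable_to_countable' fun T => ?_
    have : F ⁻¹' {T} = ⋂ x, {w | (0 < q x ∧ w ≤ cdf q x) ↔ x ∈ T} := by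
      ext w; simp [F, Finset.ext_iff]
    rw [this]
    refine MeasurableSet.iInter fun x => ?_
    by_cases hx : x ∈ T
    · simp only [hx, iff_true]
      exact (MeasurableSet.const _).inter measurableSet_Iic
    · simp only [hx, iff_false]
      exact ((MeasurableSet.const _).inter measurableSet_Iic).compl
  let Q : Finset 𝒳 → 𝒳 := fun T => if h : T.Nonempty then Finset.min' T h else Classical.arbitrary 𝒳
  have hQ : Measurable fun T => h (Q T) := fun _ _ => trivial
  exact hQ.comp hF

end Quantile

/-! ### How much of an arc each symbol occupies -/

section Occupation

variable {𝒳 : Type*} [Fintype 𝒳] [LinearOrder 𝒳] [Nonempty 𝒳]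

/-- Indicator of the points of the circle that are mapped to `x`. -/
def symbolInd (q : 𝒳 → ℝ) (x : 𝒳) (z : ℝ) : ℝ := if quantile q (Int.fract z) = x then 1 else 0

/-- Length of the part of the arc `[a, a+s] mod 1` that is mapped to `x`. -/
def occ (q : 𝒳 → ℝ) (x : 𝒳) (s a : ℝ) : ℝ := ∫ z in a..(a + s), symbolInd q x z

lemma measurable_symbolInd (q : 𝒳 → ℝ) (x : 𝒳) : Measurable (symbolInd q x) :=
  (measurable_comp_quantile q (fun x' => if x' = x then (1 : ℝ) else 0)).comp measurable_fract

lemma symbolInd_nonneg (q : 𝒳 → ℝ) (x : 𝒳) (z : ℝ) : 0 ≤ symbolInd q x z := by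
  unfold symbolInd; split_ifs <;> norm_num

lemma symbolInd_le_one (q : 𝒳 → ℝ) (x : 𝒳) (z : ℝ) : symbolInd q x z ≤ 1 := by
  unfold symbolInd; split_ifs <;> norm_num

lemma sum_symbolInd_mul (q : 𝒳 → ℝ) (h : 𝒳 → ℝ) (z : ℝ) :
    ∑ x, symbolInd q x z * h x = h (quantile q (Int.fract z)) := by
  simp [symbolInd]

lemma symbolInd_periodic (q : 𝒳 → ℝ) (x : 𝒳) : Function.Periodic (symbolInd q x) 1 := by
  intro z; simp [symbolInd]

lemma intervalIntegrable_symbolInd (q : 𝒳 → ℝ) (x : 𝒳) (a b : ℝ) :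
    IntervalIntegrable (symbolInd q x) volume a b := by
  refine (intervalIntegrable_const (c := (1 : ℝ))).mono_fun
    (measurable_symbolInd q x).aestronglyMeasurable (ae_of_all _ fun z => ?_)
  simpa [abs_of_nonneg (symbolInd_nonneg q x z)] using symbolInd_le_one q x z

lemma occ_add (q : 𝒳 → ℝ) (x : 𝒳) (s t a : ℝ) :
    occ q x (s + t) a = occ q x s a + occ q x t (a + s) := by
  unfold occ
  rw [intervalIntegral.integral_add_adjacent_intervals
    (intervalIntegrable_symbolInd q x _ _) (intervalIntegrable_symbolInd q x _ _), add_assoc]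

lemma occ_nonneg (q : 𝒳 → ℝ) (x : 𝒳) {s : ℝ} (hs : 0 ≤ s) (a : ℝ) : 0 ≤ occ q x s a :=
  intervalIntegral.integral_nonneg (by linarith) fun z _ => symbolInd_nonneg q x z

lemma sum_occ_mul (q : 𝒳 → ℝ) (h : 𝒳 → ℝ) (s a : ℝ) :
    ∑ x, occ q x s a * h x = ∫ z in a..(a + s), h (quantile q (Int.fract z)) := by
  simp_rw [← sum_symbolInd_mul]
  rw [intervalIntegral.integral_finsetSum
    (fun x _ => (intervalIntegrable_symbolInd q x _ _).mul_const _)]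
  simp [occ]

lemma sum_occ (q : 𝒳 → ℝ) (s a : ℝ) : ∑ x, occ q x s a = s := by
  simpa using sum_occ_mul q (fun _ => 1) s a

lemma integral_symbolInd_zero_one {q : 𝒳 → ℝ} (hq : q ∈ stdSimplex ℝ 𝒳) (x : 𝒳) :
    ∫ z in (0 : ℝ)..1, symbolInd q x z = q x := by
  have h0 := cdfLT_nonneg hq.1 x
  have h1 := cdf_le_one hq x
  have h2 := cdf_eq_cdfLT_add q x
  have h3 : ∫ z in Ioo (0 : ℝ) 1, symbolInd q x z =
      ∫ z in Ioo (0 : ℝ) 1, (Ioc (cdfLT q x) (cdf q x)).indicator (fun _ => (1 : ℝ)) z := by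
    refine setIntegral_congr_fun measurableSet_Ioo fun z hz => ?_
    have hf : Int.fract z = z := Int.fract_eq_self.mpr ⟨hz.1.le, hz.2⟩
    simp only [symbolInd, hf, indicator, quantile_eq_iff hq ⟨hz.1, hz.2.le⟩]
  rw [intervalIntegral.integral_of_le zero_le_one, integral_Ioc_eq_integral_Ioo, h3,
    ← integral_Ioc_eq_integral_Ioo, setIntegral_indicator measurableSet_Ioc,
    inter_eq_self_of_subset_right (Ioc_subset_Ioc h0 h1)]
  simp [h2, hq.1 x]

lemma occ_one {q : 𝒳 → ℝ} (hq : q ∈ stdSimplex ℝ 𝒳) (x : 𝒳) (a : ℝ) : occ q x 1 a = q x := by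
  rw [occ, (symbolInd_periodic q x).intervalIntegral_add_eq a 0, zero_add,
    integral_symbolInd_zero_one hq]

lemma occ_le {q : 𝒳 → ℝ} (hq : q ∈ stdSimplex ℝ 𝒳) (x : 𝒳) {s : ℝ} (hs : s ≤ 1) (a : ℝ) :
    occ q x s a ≤ q x := by
  have h := occ_add q x s (1 - s) a
  rw [add_sub_cancel, occ_one hq] at h
  linarith [occ_nonneg q x (sub_nonneg.mpr hs) (a + s)]

lemma occ_eq_sub (q : 𝒳 → ℝ) (x : 𝒳) (s a : ℝ) :
    occ q x s a = (∫ z in (0 : ℝ)..(a + s), symbolInd q x z) - ∫ z in (0 : ℝ)..a, symbolInd q x z := by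
  rw [occ, intervalIntegral.integral_interval_sub_left
    (intervalIntegrable_symbolInd q x _ _) (intervalIntegrable_symbolInd q x _ _)]

lemma continuous_occ (q : 𝒳 → ℝ) (x : 𝒳) : Continuous fun z : ℝ × ℝ => occ q x z.1 z.2 := by
  have h : Continuous fun b => ∫ z in (0 : ℝ)..b, symbolInd q x z :=
    intervalIntegral.continuous_primitive (intervalIntegrable_symbolInd q x) 0
  simp_rw [occ_eq_sub]
  fun_prop

lemma occ_fract (q : 𝒳 → ℝ) (x : 𝒳) (a b : ℝ) :
    occ q x b (Int.fract a) = occ q x b a := by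
  unfold occ
  have h := intervalIntegral.integral_comp_add_right (a := Int.fract a) (b := Int.fract a + b)
    (symbolInd q x) (⌊a⌋ : ℝ)
  have h2 : ∀ z, symbolInd q x (z + (⌊a⌋ : ℝ)) = symbolInd q x z := fun z => by simp [symbolInd]
  simp_rw [h2] at h
  rw [h]
  congr 1
  · exact Int.fract_add_floor a
  · rw [add_right_comm, Int.fract_add_floor a]

lemma occ_of_const {q : 𝒳 → ℝ} {x : 𝒳} {s a : ℝ} (hs : 0 ≤ s)
    (h : ∀ z ∈ Ioo a (a + s), quantile q (Int.fract z) = x) (x' : 𝒳) :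
    occ q x' s a = if x = x' then s else 0 := by
  rw [occ, intervalIntegral.integral_of_le (by linarith), integral_Ioc_eq_integral_Ioo,
    setIntegral_congr_fun (g := fun _ => if x = x' then (1 : ℝ) else 0) measurableSet_Ioo
      (fun z hz => by simp [symbolInd, h z hz])]
  split_ifs <;> simp [hs]

lemma integral_comp_quantile {q : 𝒳 → ℝ} (hq : q ∈ stdSimplex ℝ 𝒳) (h : 𝒳 → ℝ) :
    ∫ w in (0 : ℝ)..1, h (quantile q w) = ∑ x, q x * h x := by
  have h1 := sum_occ_mul q h 1 0
  simp_rw [occ_one hq, zero_add] at h1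
  rw [h1, intervalIntegral.integral_of_le zero_le_one, intervalIntegral.integral_of_le zero_le_one,
    integral_Ioc_eq_integral_Ioo, integral_Ioc_eq_integral_Ioo]
  refine setIntegral_congr_fun measurableSet_Ioo fun z hz => ?_
  simp only [Int.fract_eq_self.mpr ⟨hz.1.le, hz.2⟩]

end Occupation

/-! ### Output pmf and likelihood ratios -/

section Channel

variable {𝒳 𝒴 : Type*} [Fintype 𝒳]

/-- The likelihood ratio `p(y|x) / p(y)`. -/
def likRatio (p : 𝒳 → 𝒴 → ℝ) (q : 𝒳 → ℝ) (x : 𝒳) (y : 𝒴) : ℝ := p x y / outputPMF p q y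

variable {p : 𝒳 → 𝒴 → ℝ} {q : 𝒳 → ℝ}

lemma sum_mul_likRatio {y : 𝒴} (hy : outputPMF p q y ≠ 0) :
    ∑ x, q x * likRatio p q x y = 1 := by
  simp only [likRatio, ← mul_div_assoc]
  rw [← Finset.sum_div]
  exact div_self hy

lemma sum_mul_likRatio_le_one (y : 𝒴) : ∑ x, q x * likRatio p q x y ≤ 1 := by
  by_cases hy : outputPMF p q y = 0
  · simp [likRatio, hy]
  · exact (sum_mul_likRatio hy).le

variable [Fintype 𝒴]

lemma outputPMF_nonneg (hp : IsChannel p) (hq : q ∈ stdSimplex ℝ 𝒳) (y : 𝒴) :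
    0 ≤ outputPMF p q y :=
  Finset.sum_nonneg fun x _ => mul_nonneg (hq.1 x) ((hp x).1 y)

lemma sum_outputPMF (hp : IsChannel p) (hq : q ∈ stdSimplex ℝ 𝒳) :
    ∑ y, outputPMF p q y = 1 := by
  unfold outputPMF
  rw [Finset.sum_comm]
  simp [← Finset.mul_sum, (hp _).2, hq.2]

lemma outputPMF_pos (hp : IsChannel p) (hq : q ∈ stdSimplex ℝ 𝒳) {x : 𝒳} {y : 𝒴} (hx : 0 < q x)
    (hy : 0 < p x y) : 0 < outputPMF p q y :=
  (mul_pos hx hy).trans_le (Finset.single_le_sum (f := fun x => q x * p x y)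
    (fun x _ => mul_nonneg (hq.1 x) ((hp x).1 y)) (Finset.mem_univ x))

lemma likRatio_nonneg (hp : IsChannel p) (hq : q ∈ stdSimplex ℝ 𝒳) (x : 𝒳) (y : 𝒴) :
    0 ≤ likRatio p q x y :=
  div_nonneg ((hp x).1 y) (outputPMF_nonneg hp hq y)

/-- A bound for the likelihood ratios. -/
def likRatioBound (p : 𝒳 → 𝒴 → ℝ) (q : 𝒳 → ℝ) : ℝ := 1 + ∑ x, ∑ y, likRatio p q x y

lemma one_le_likRatioBound (hp : IsChannel p) (hq : q ∈ stdSimplex ℝ 𝒳) :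
    1 ≤ likRatioBound p q :=
  le_add_of_nonneg_right (Finset.sum_nonneg fun x _ => Finset.sum_nonneg fun y _ =>
    likRatio_nonneg hp hq x y)

lemma likRatio_le_bound (hp : IsChannel p) (hq : q ∈ stdSimplex ℝ 𝒳) (x : 𝒳) (y : 𝒴) :
    likRatio p q x y ≤ likRatioBound p q := by
  have h1 := Finset.single_le_sum (f := fun y => likRatio p q x y)
    (fun y _ => likRatio_nonneg hp hq x y) (Finset.mem_univ y)
  have h2 := Finset.single_le_sum (f := fun x => ∑ y, likRatio p q x y)
    (fun x _ => Finset.sum_nonneg fun y _ => likRatio_nonneg hp hq x y) (Finset.mem_univ x)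
  rw [likRatioBound]
  linarith

end Channel

/-! ### Posterior mass of an arc -/

section ArcMass

variable {𝒳 𝒴 : Type*} [Fintype 𝒳] [LinearOrder 𝒳] [Nonempty 𝒳]

/-- The density is constant on each symbol's interval. This turns the analysis of the update into
finite sums over symbols. -/
lemma arcMass_eq {q : 𝒳 → ℝ} (hq : q ∈ stdSimplex ℝ 𝒳) (p : 𝒳 → 𝒴 → ℝ) (y : 𝒴) (s a : ℝ) :
    arcMass p q y s a = ∑ x, occ q x s a * likRatio p q x y := by
  rw [sum_occ_mul q (fun x => likRatio p q x y)]
  simp only [arcMass, condDensity, integral_comp_quantile hq (fun x => p x y), likRatio, outputPMF]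

lemma continuous_arcMass {q : 𝒳 → ℝ} (hq : q ∈ stdSimplex ℝ 𝒳) (p : 𝒳 → 𝒴 → ℝ) (y : 𝒴) :
    Continuous fun z : ℝ × ℝ => arcMass p q y z.1 z.2 := by
  simp_rw [arcMass_eq hq]
  have := continuous_occ q
  fun_prop

lemma arcMass_add {q : 𝒳 → ℝ} (hq : q ∈ stdSimplex ℝ 𝒳) (p : 𝒳 → 𝒴 → ℝ) (y : 𝒴) (s t a : ℝ) :
    arcMass p q y (s + t) a = arcMass p q y s a + arcMass p q y t (a + s) := by
  simp_rw [arcMass_eq hq, occ_add, add_mul, Finset.sum_add_distrib]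

lemma arcMass_fract {q : 𝒳 → ℝ} (hq : q ∈ stdSimplex ℝ 𝒳) (p : 𝒳 → 𝒴 → ℝ) (y : 𝒴) (s a : ℝ) :
    arcMass p q y s (Int.fract a) = arcMass p q y s a := by
  simp_rw [arcMass_eq hq, occ_fract]

variable {p : 𝒳 → 𝒴 → ℝ} {q : 𝒳 → ℝ}

lemma arcMass_one (hq : q ∈ stdSimplex ℝ 𝒳) {y : 𝒴} (hy : outputPMF p q y ≠ 0)
    (a : ℝ) : arcMass p q y 1 a = 1 := by
  simp_rw [arcMass_eq hq, occ_one hq]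
  exact sum_mul_likRatio hy

variable [Fintype 𝒴]

lemma arcMass_nonneg (hp : IsChannel p) (hq : q ∈ stdSimplex ℝ 𝒳) (y : 𝒴) {s : ℝ} (hs : 0 ≤ s)
    (a : ℝ) : 0 ≤ arcMass p q y s a := by
  rw [arcMass_eq hq]
  exact Finset.sum_nonneg fun x _ => mul_nonneg (occ_nonneg q x hs a) (likRatio_nonneg hp hq x y)

lemma arcMass_le_one (hp : IsChannel p) (hq : q ∈ stdSimplex ℝ 𝒳) (y : 𝒴) {s : ℝ} (hs : s ≤ 1)
    (a : ℝ) : arcMass p q y s a ≤ 1 := by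
  rw [arcMass_eq hq]
  refine le_trans (Finset.sum_le_sum fun x _ => ?_) (sum_mul_likRatio_le_one (p := p) (q := q) y)
  exact mul_le_mul_of_nonneg_right (occ_le hq x hs a) (likRatio_nonneg hp hq x y)

end ArcMass

/-! ### Information gain of the selected symbol -/

section BestSymbol

open InformationTheory

variable {𝒳 𝒴 : Type*} [Fintype 𝒳] [LinearOrder 𝒳] [Nonempty 𝒳]

lemma exists_inputAt_eq {q : 𝒳 → ℝ} {x : 𝒳} {s a : ℝ} (hs : 0 < s) (h : 0 < occ q x s a) :
    ∃ v ∈ Icc (0 : ℝ) 1, inputAt q s a v = x := by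
  by_contra! hne
  have h0 : occ q x s a = 0 := by
    rw [occ]
    refine intervalIntegral.integral_zero_ae (ae_of_all _ fun z hz => ?_)
    rw [uIoc_of_le (by linarith)] at hz
    have := hne ((z - a) / s) ⟨div_nonneg (by linarith [hz.1]) hs.le,
      (div_le_one hs).mpr (by linarith [hz.2])⟩
    rw [inputAt, div_mul_cancel₀ _ hs.ne', sub_add_cancel] at this
    simp [symbolInd, this]
  exact h.ne' h0

variable [Fintype 𝒴]

/-- `x` maximizes the expected information gain among the symbols that occupy a part of positive
length of the arc `[a, a+s] mod 1`. -/
def IsBestSymbol (p : 𝒳 → 𝒴 → ℝ) (q : 𝒳 → ℝ) (s a : ℝ) (x : 𝒳) : Prop :=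
  0 < q x ∧ ∀ x', 0 < occ q x' s a → expLogLength p q s a x' ≤ expLogLength p q s a x

/-- Expected information gain `E[ln (S' / s)]` when `x` is sent. -/
def infoGain (p : 𝒳 → 𝒴 → ℝ) (q : 𝒳 → ℝ) (s a : ℝ) (x : 𝒳) : ℝ :=
  ∑ y, p x y * Real.log (arcMass p q y s a / s)

/-- Relative entropy of the output distribution of the arc `[a, a+s] mod 1` with respect to the
output pmf. -/
def arcDivergence (p : 𝒳 → 𝒴 → ℝ) (q : 𝒳 → ℝ) (s a : ℝ) : ℝ :=
  ∑ y, outputPMF p q y * klFun (arcMass p q y s a / s)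

variable {p : 𝒳 → 𝒴 → ℝ} {q : 𝒳 → ℝ} {V : ℝ → ℝ → ℝ} {s a : ℝ} {x : 𝒳}

/-- The analysis uses only this consequence of maximality, so it does not depend on how ties are
broken. Symbols met by the arc in a null set are not compared. -/
lemma IsMaxInfoGainRule.isBestSymbol (hq : q ∈ stdSimplex ℝ 𝒳) (hV : IsMaxInfoGainRule p q V)
    (hs : s ∈ Ioc (0 : ℝ) 1) (ha : a ∈ Ico (0 : ℝ) 1) :
    IsBestSymbol p q s a (inputAt q s a (V s a)) := by
  refine ⟨(quantile_spec hq (Int.fract_lt_one _).le).1, fun x hx => ?_⟩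
  obtain ⟨v, hv, rfl⟩ := exists_inputAt_eq hs.1 hx
  exact hV.isMax s hs a ha hv

/-- This is Bayes' rule. It survives `p(y) = 0`: a symbol occupying positive length has positive
probability, so it cannot produce such a `y`. -/
lemma outputPMF_mul_arcMass (hp : IsChannel p) (hq : q ∈ stdSimplex ℝ 𝒳) (hs : s ∈ Icc (0 : ℝ) 1)
    (a : ℝ) (y : 𝒴) : outputPMF p q y * arcMass p q y s a = ∑ x, occ q x s a * p x y := by
  rw [arcMass_eq hq, Finset.mul_sum]
  refine Finset.sum_congr rfl fun x _ => ?_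
  by_cases hy : outputPMF p q y = 0
  · rw [hy, zero_mul]
    rcases (occ_nonneg q x hs.1 a).eq_or_lt with h | h
    · simp [← h]
    · have hqx := h.trans_le (occ_le hq x hs.2 a)
      rcases ((hp x).1 y).eq_or_lt with h' | h'
      · simp [← h']
      · exact absurd hy (outputPMF_pos hp hq hqx h').ne'
  · rw [likRatio]; field_simp

lemma arcMass_pos (hp : IsChannel p) (hq : q ∈ stdSimplex ℝ 𝒳) (hs : s ∈ Ioc (0 : ℝ) 1)
    (hx : 0 < occ q x s a) {y : 𝒴} (hy : 0 < p x y) : 0 < arcMass p q y s a := by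
  have hqx := hx.trans_le (occ_le hq x hs.2 a)
  rw [arcMass_eq hq]
  refine lt_of_lt_of_le (mul_pos hx (div_pos hy (outputPMF_pos hp hq hqx hy)))
    (Finset.single_le_sum (f := fun x => occ q x s a * likRatio p q x y)
      (fun x _ => mul_nonneg (occ_nonneg q x hs.1.le a) (likRatio_nonneg hp hq x y))
      (Finset.mem_univ x))

lemma ereal_coe_sum {ι : Type*} (t : Finset ι) (f : ι → ℝ) :
    ((∑ i ∈ t, f i : ℝ) : EReal) = ∑ i ∈ t, (f i : EReal) := by
  classical
  induction t using Finset.induction_on with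
  | empty => simp
  | insert i t hi ih => rw [Finset.sum_insert hi, Finset.sum_insert hi, EReal.coe_add, ih]

lemma expLogLength_eq_coe (hp : IsChannel p) (h : ∀ y, 0 < p x y → 0 < arcMass p q y s a) :
    expLogLength p q s a x = ((∑ y, p x y * Real.log (arcMass p q y s a) : ℝ) : EReal) := by
  rw [expLogLength, ereal_coe_sum]
  refine Finset.sum_congr rfl fun y _ => ?_
  rcases ((hp x).1 y).eq_or_lt with h0 | h0
  · simp [← h0]
  · rw [ENNReal.log_ofReal_of_pos (h y h0), EReal.coe_mul]

lemma expLogLength_eq_bot {y : 𝒴} (hy : 0 < p x y) (h : arcMass p q y s a ≤ 0) :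
    expLogLength p q s a x = ⊥ := by
  classical
  rw [expLogLength, ← Finset.add_sum_erase _ _ (Finset.mem_univ y), ENNReal.ofReal_of_nonpos h,
    ENNReal.log_zero, EReal.coe_mul_bot_of_pos hy, EReal.bot_add]

lemma infoGain_eq (hp : IsChannel p) (hs : 0 < s) (h : ∀ y, 0 < p x y → 0 < arcMass p q y s a) :
    infoGain p q s a x = (∑ y, p x y * Real.log (arcMass p q y s a)) - Real.log s := by
  have h1 : Real.log s = ∑ y, p x y * Real.log s := by rw [← Finset.sum_mul, (hp x).2, one_mul]
  rw [h1, ← Finset.sum_sub_distrib]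
  refine Finset.sum_congr rfl fun y _ => ?_
  rcases ((hp x).1 y).eq_or_lt with h0 | h0
  · simp [← h0]
  · rw [Real.log_div (h y h0).ne' hs.ne', mul_sub]

lemma exists_occ_pos (q : 𝒳 → ℝ) (hs : 0 < s) (a : ℝ) : ∃ x, 0 < occ q x s a := by
  obtain ⟨z, _, hz0⟩ := Finset.exists_lt_of_sum_lt (s := Finset.univ)
    (f := fun _ => (0 : ℝ)) (g := fun x => occ q x s a) (by simpa [sum_occ] using hs)
  exact ⟨z, hz0⟩

namespace IsBestSymbol

/-- A symbol of positive length on the arc has a finite expected log length, so a best symbol cannot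
have the value `⊥`. -/
lemma arcMass_pos (hp : IsChannel p) (hq : q ∈ stdSimplex ℝ 𝒳) (hs : s ∈ Ioc (0 : ℝ) 1)
    (hx : IsBestSymbol p q s a x) {y : 𝒴} (hy : 0 < p x y) : 0 < arcMass p q y s a := by
  by_contra! hle
  obtain ⟨x', hx'⟩ := exists_occ_pos q hs.1 a
  have h := hx.2 x' hx'
  rw [expLogLength_eq_bot hy hle,
    expLogLength_eq_coe hp (fun y hy => FeedbackScheme.arcMass_pos hp hq hs hx' hy)] at h
  exact absurd h (by simp)

lemma infoGain_le (hp : IsChannel p) (hq : q ∈ stdSimplex ℝ 𝒳) (hs : s ∈ Ioc (0 : ℝ) 1)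
    (hx : IsBestSymbol p q s a x) {x' : 𝒳} (hx' : 0 < occ q x' s a) :
    infoGain p q s a x' ≤ infoGain p q s a x := by
  have h1 := fun y hy => FeedbackScheme.arcMass_pos (y := y) hp hq hs hx' hy
  have h2 := fun y hy => hx.arcMass_pos (y := y) hp hq hs hy
  rw [infoGain_eq hp hs.1 h1, infoGain_eq hp hs.1 h2]
  have h := hx.2 x' hx'
  rw [expLogLength_eq_coe hp h1, expLogLength_eq_coe hp h2, EReal.coe_le_coe_iff] at h
  linarith

end IsBestSymbol

lemma sum_outputPMF_mul_arcMass (hp : IsChannel p) (hq : q ∈ stdSimplex ℝ 𝒳)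
    (hs : s ∈ Icc (0 : ℝ) 1) (a : ℝ) : ∑ y, outputPMF p q y * arcMass p q y s a = s := by
  simp_rw [outputPMF_mul_arcMass hp hq hs]
  rw [Finset.sum_comm]
  simp_rw [← Finset.mul_sum, (hp _).2, mul_one, sum_occ]

/-- The average information gain over the arc is the relative entropy of the arc. -/
lemma arcDivergence_eq (hp : IsChannel p) (hq : q ∈ stdSimplex ℝ 𝒳) (hs : s ∈ Ioc (0 : ℝ) 1)
    (a : ℝ) : arcDivergence p q s a = ∑ x, occ q x s a / s * infoGain p q s a x := by
  have hs' : s ∈ Icc (0 : ℝ) 1 := ⟨hs.1.le, hs.2⟩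
  have h1 : ∑ x, occ q x s a / s * infoGain p q s a x =
      ∑ y, outputPMF p q y * (arcMass p q y s a / s * Real.log (arcMass p q y s a / s)) := by
    simp_rw [infoGain, Finset.mul_sum]
    rw [Finset.sum_comm]
    refine Finset.sum_congr rfl fun y _ => ?_
    rw [← mul_assoc, ← mul_div_assoc, outputPMF_mul_arcMass hp hq hs', Finset.sum_div,
      Finset.sum_mul]
    exact Finset.sum_congr rfl fun x _ => by ring
  have h2 : ∑ y, outputPMF p q y * (1 - arcMass p q y s a / s) = 0 := by
    simp_rw [mul_sub, mul_one, Finset.sum_sub_distrib, ← mul_div_assoc]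
    rw [← Finset.sum_div, sum_outputPMF hp hq, sum_outputPMF_mul_arcMass hp hq hs',
      div_self hs.1.ne', sub_self]
  rw [h1, ← add_zero (∑ y, _), ← h2, ← Finset.sum_add_distrib]
  exact Finset.sum_congr rfl fun y _ => by rw [klFun]; ring

lemma arcDivergence_nonneg (hp : IsChannel p) (hq : q ∈ stdSimplex ℝ 𝒳) (hs : 0 ≤ s)
    (a : ℝ) : 0 ≤ arcDivergence p q s a :=
  Finset.sum_nonneg fun y _ => mul_nonneg (outputPMF_nonneg hp hq y)
    (klFun_nonneg (div_nonneg (arcMass_nonneg hp hq y hs a) hs))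

/-- A maximum is at least the average with weights `occ q x' s a / s`, and that average is the
relative entropy by `arcDivergence_eq`. -/
lemma IsBestSymbol.arcDivergence_le (hp : IsChannel p) (hq : q ∈ stdSimplex ℝ 𝒳)
    (hs : s ∈ Ioc (0 : ℝ) 1) (hx : IsBestSymbol p q s a x) :
    arcDivergence p q s a ≤ infoGain p q s a x := by
  rw [arcDivergence_eq hp hq hs]
  have h1 : infoGain p q s a x = ∑ x', occ q x' s a / s * infoGain p q s a x := by
    rw [← Finset.sum_mul, ← Finset.sum_div, sum_occ, div_self hs.1.ne', one_mul]
  rw [h1]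
  refine Finset.sum_le_sum fun x' _ => ?_
  rcases (occ_nonneg q x' hs.1.le a).eq_or_lt with h | h
  · simp [← h]
  · exact mul_le_mul_of_nonneg_left (hx.infoGain_le hp hq hs h) (div_nonneg h.le hs.1.le)

lemma arcMass_le (hp : IsChannel p) (hq : q ∈ stdSimplex ℝ 𝒳) (hs : 0 ≤ s) (a : ℝ) (y : 𝒴) :
    arcMass p q y s a ≤ s * likRatioBound p q := by
  rw [arcMass_eq hq, ← sum_occ q s a, Finset.sum_mul]
  simp_rw [sum_occ]
  exact Finset.sum_le_sum fun x _ => mul_le_mul_of_nonneg_left (likRatio_le_bound hp hq x y)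
    (occ_nonneg q x hs a)

/-- The complement is an arc of length `1 - s`, to which `arcMass_le` applies. -/
lemma one_sub_arcMass_le (hp : IsChannel p) (hq : q ∈ stdSimplex ℝ 𝒳) (hs : s ≤ 1) (a : ℝ) {y : 𝒴}
    (hy : outputPMF p q y ≠ 0) : 1 - arcMass p q y s a ≤ (1 - s) * likRatioBound p q := by
  have h := arcMass_add hq p y s (1 - s) a
  rw [add_sub_cancel, arcMass_one hq hy] at h
  linarith [arcMass_le hp hq (sub_nonneg.mpr hs) (a + s) y]

lemma abs_log_le_of_half_le {t : ℝ} (h1 : 1 / 2 ≤ t) (h2 : t ≤ 1) : |Real.log t| ≤ 2 * (1 - t) := by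
  have ht : 0 < t := by linarith
  rw [abs_of_nonpos (Real.log_nonpos ht.le h2)]
  have h := Real.one_sub_inv_le_log_of_pos ht
  have h3 : t⁻¹ - 1 ≤ 2 * (1 - t) := by
    rw [inv_eq_one_div, div_sub_one ht.ne', div_le_iff₀ ht]
    nlinarith
  linarith

/-- The one-step information gain is at most of the order of `1 - s`. -/
lemma exists_abs_log_le (hp : IsChannel p) (hq : q ∈ stdSimplex ℝ 𝒳) :
    ∃ B > 0, ∀ s ∈ Ioo (0 : ℝ) 1, ∀ a x, IsBestSymbol p q s a x → ∀ y, 0 < p x y →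
      |Real.log (arcMass p q y s a / s)| ≤ B * (1 - s) := by
  set D := likRatioBound p q with hD
  have hD1 : 1 ≤ D := one_le_likRatioBound hp hq
  have hlD : 0 ≤ Real.log D := Real.log_nonneg hD1
  set Q := 1 + ∑ x, ∑ y, (p x y)⁻¹ with hQ
  have hinv : ∀ x y, (p x y)⁻¹ ≤ Q := by
    intro x y
    have h0 : ∀ x y, 0 ≤ (p x y)⁻¹ := fun x y => inv_nonneg.mpr ((hp x).1 y)
    have h1 := Finset.single_le_sum (f := fun y => (p x y)⁻¹) (fun y _ => h0 x y) (Finset.mem_univ y)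
    have h2 := Finset.single_le_sum (f := fun x => ∑ y, (p x y)⁻¹)
      (fun x _ => Finset.sum_nonneg fun y _ => h0 x y) (Finset.mem_univ x)
    rw [hQ]; linarith
  have hQ1 : 1 ≤ Q := le_add_of_nonneg_right (Finset.sum_nonneg fun x _ =>
    Finset.sum_nonneg fun y _ => inv_nonneg.mpr ((hp x).1 y))
  -- The logarithms are at most `log D` and their mean is nonnegative, so none with `p x y > 0` can
  -- be very negative: its deficit from `log D`, weighted by `p x y ≥ 1/Q`, is at most `log D`.
  have hglob : ∀ s ∈ Ioo (0 : ℝ) 1, ∀ a x, IsBestSymbol p q s a x → ∀ y, 0 < p x y →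
      |Real.log (arcMass p q y s a / s)| ≤ Real.log D * Q := by
    intro s hs a x hx y hy
    have hs' : s ∈ Ioc (0 : ℝ) 1 := ⟨hs.1, hs.2.le⟩
    have hup : ∀ y, 0 < p x y → Real.log (arcMass p q y s a / s) ≤ Real.log D := by
      intro y hy
      refine Real.log_le_log (div_pos (hx.arcMass_pos hp hq hs' hy) hs.1) ?_
      rw [div_le_iff₀ hs.1, mul_comm]
      exact arcMass_le hp hq hs.1.le a y
    have hE : 0 ≤ infoGain p q s a x :=
      (arcDivergence_nonneg hp hq hs.1.le a).trans (hx.arcDivergence_le hp hq hs')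
    have hsum : ∑ y, p x y * (Real.log D - Real.log (arcMass p q y s a / s)) ≤ Real.log D := by
      simp_rw [mul_sub, Finset.sum_sub_distrib]
      rw [← Finset.sum_mul, (hp x).2, one_mul]
      exact sub_le_self _ hE
    have hsingle := (Finset.single_le_sum
      (f := fun y => p x y * (Real.log D - Real.log (arcMass p q y s a / s)))
      (fun y _ => by
        rcases ((hp x).1 y).eq_or_lt with h | h
        · simp [← h]
        · exact mul_nonneg h.le (sub_nonneg.mpr (hup y h))) (Finset.mem_univ y)).trans hsum
    have h2 : Real.log D - Real.log (arcMass p q y s a / s) ≤ Real.log D * (p x y)⁻¹ := by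
      rw [← div_eq_mul_inv, le_div_iff₀ hy, mul_comm]
      exact hsingle
    have h3 := mul_le_mul_of_nonneg_left (hinv x y) hlD
    rw [abs_le]
    constructor
    · linarith
    · nlinarith [hup y hy]
  -- Near `s = 1`, the logs of the new mass and of `s` contribute at most `2D(1-s)` each. Otherwise
  -- `1 < 2D(1-s)`, and the global bound is multiplied by this factor.
  refine ⟨4 * D + 2 * D * (Real.log D * Q), by positivity, fun s hs a x hx y hy => ?_⟩
  have hs' : s ∈ Ioc (0 : ℝ) 1 := ⟨hs.1, hs.2.le⟩
  have h1s : 0 < 1 - s := by linarith [hs.2]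
  have hpos : 0 ≤ Real.log D * Q := mul_nonneg hlD (by linarith)
  by_cases hnear : (1 - s) * D ≤ 1 / 2
  · have hy0 : outputPMF p q y ≠ 0 := (outputPMF_pos hp hq hx.1 hy).ne'
    have hA := one_sub_arcMass_le hp hq hs.2.le a hy0
    have hA1 := arcMass_le_one hp hq y hs.2.le a
    rw [Real.log_div (hx.arcMass_pos hp hq hs' hy).ne' hs.1.ne']
    have h1 := abs_log_le_of_half_le (t := arcMass p q y s a) (by linarith) hA1
    have h2 := abs_log_le_of_half_le (t := s) (by nlinarith) hs.2.le
    have h3 := abs_sub (Real.log (arcMass p q y s a)) (Real.log s)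
    have h4 : 0 ≤ 2 * D * (Real.log D * Q) * (1 - s) := by positivity
    nlinarith
  · push Not at hnear
    have h1 := hglob s hs a x hx y hy
    have h2 : 0 ≤ 4 * D * (1 - s) := by positivity
    nlinarith

end BestSymbol

/-! ### Measurable selection of a maximizing point -/

section RuleExistence

variable {𝒳 𝒴 : Type*} [Fintype 𝒳] [LinearOrder 𝒳] [Nonempty 𝒳]

/-- Every symbol that is attained on the arc is attained at a rational parameter. -/
lemma exists_rat_inputAt_eq {q : 𝒳 → ℝ} (hq : q ∈ stdSimplex ℝ 𝒳) {s a v : ℝ} (hs : 0 < s)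
    (hv : v ∈ Icc (0 : ℝ) 1) :
    ∃ r : ℚ, (r : ℝ) ∈ Icc (0 : ℝ) 1 ∧ inputAt q s a r = inputAt q s a v := by
  rcases hv.1.eq_or_lt with rfl | hv0
  · exact ⟨0, by simp, by simp⟩
  rcases hv.2.eq_or_lt with rfl | hv1
  · exact ⟨1, by simp, by simp⟩
  set w := v * s + a with hw
  -- It is enough that the symbol be constant on a one-sided neighbourhood of `v`: to the right if
  -- the point is `0` on the circle, to the left otherwise, since symbol intervals are closed on the
  -- right.
  suffices h : ∃ b c : ℝ, b < c ∧ b ≤ v ∧ v ≤ c ∧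
      ∀ r ∈ Ioo b c, quantile q (Int.fract (r * s + a)) = quantile q (Int.fract w) by
    obtain ⟨b, c, hbc, hbv, hvc, h⟩ := h
    have hlt : max b 0 < min c 1 := by
      rw [max_lt_iff, lt_min_iff, lt_min_iff]
      exact ⟨⟨hbc, hbv.trans_lt hv1⟩, hv0.trans_le hvc, one_pos⟩
    obtain ⟨r, hr1, hr2⟩ := exists_rat_btwn hlt
    rw [max_lt_iff] at hr1
    rw [lt_min_iff] at hr2
    exact ⟨r, ⟨hr1.2.le, hr2.2.le⟩, h r ⟨hr1.1, hr2.1⟩⟩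
  have hfr : ∀ {δ : ℝ}, 0 ≤ Int.fract w + δ → Int.fract w + δ < 1 →
      Int.fract (w + δ) = Int.fract w + δ := by
    intro δ h1 h2
    rw [Int.fract_eq_iff]
    exact ⟨h1, h2, ⌊w⌋, by rw [← Int.self_sub_floor w]; ring⟩
  have hrw : ∀ r, r * s + a = w + (r - v) * s := fun r => by rw [hw]; ring
  rcases (Int.fract_nonneg w).eq_or_lt with h0 | h0
  · have hq0 : 0 < q (quantile q 0) := (quantile_spec hq zero_le_one).1
    have hq1 : q (quantile q 0) ≤ 1 := by
      have := cdf_le_one hq (quantile q 0)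
      rw [cdf_eq_cdfLT_add] at this
      linarith [cdfLT_nonneg hq.1 (quantile q 0)]
    refine ⟨v, v + q (quantile q 0) / s, by simp [hs, hq0], le_rfl, by
      simp [div_nonneg hq0.le hs.le], ?_⟩
    rintro r ⟨hr1, hr2⟩
    have h1 : 0 < (r - v) * s := mul_pos (by linarith) hs
    have h2 : (r - v) * s < q (quantile q 0) := by rw [← lt_div_iff₀ hs]; linarith
    rw [hrw, hfr (by linarith) (by linarith), ← h0, zero_add]
    exact quantile_eq_quantile_zero hq ⟨h1.le, h2.le⟩
  · have hf1 := Int.fract_lt_one w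
    have h1 := (quantile_eq_iff hq ⟨h0, hf1.le⟩ (x := quantile q (Int.fract w))).mp rfl
    set x := quantile q (Int.fract w) with hx
    have hlo := cdfLT_nonneg hq.1 x
    refine ⟨v - (Int.fract w - cdfLT q x) / s, v, ?_, ?_, le_rfl, ?_⟩
    · simp [hs, h1.1]
    · simp [div_nonneg (sub_nonneg.mpr h1.1.le) hs.le]
    rintro r ⟨hr1, hr2⟩
    have h2 : (r - v) * s < 0 := mul_neg_of_neg_of_pos (by linarith) hs
    have h3 : (v - r) * s < Int.fract w - cdfLT q x := by rw [← lt_div_iff₀ hs]; linarith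
    rw [hrw, hfr (by nlinarith) (by linarith), quantile_eq_iff hq ⟨by nlinarith, by linarith⟩]
    exact ⟨by nlinarith, by linarith [h1.2]⟩

variable [Fintype 𝒴]

lemma measurable_expLogLength {q : 𝒳 → ℝ} (hq : q ∈ stdSimplex ℝ 𝒳) (p : 𝒳 → 𝒴 → ℝ) (v : ℝ) :
    Measurable fun z : ℝ × ℝ => expLogLength p q z.1 z.2 (inputAt q z.1 z.2 v) := by
  unfold expLogLength
  refine Finset.measurable_sum _ fun y _ => Measurable.mul ?_ ?_
  · refine Measurable.coe_real_ereal ?_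
    exact (measurable_comp_quantile q fun x => p x y).comp
      (measurable_fract.comp (by fun_prop))
  · exact ENNReal.measurable_log.comp
      (ENNReal.measurable_ofReal.comp (continuous_arcMass hq p y).measurable)

/-- A measurable maximal information gain rule exists. -/
lemma exists_isMaxInfoGainRule {q : 𝒳 → ℝ} (hq : q ∈ stdSimplex ℝ 𝒳) (p : 𝒳 → 𝒴 → ℝ) :
    ∃ V, IsMaxInfoGainRule p q V := by
  classical
  have : Nonempty {r : ℚ // (r : ℝ) ∈ Icc (0 : ℝ) 1} := ⟨⟨0, by simp⟩⟩
  obtain ⟨e, he⟩ := exists_surjective_nat {r : ℚ // (r : ℝ) ∈ Icc (0 : ℝ) 1}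
  let f : ℕ → ℝ × ℝ → EReal := fun k z =>
    expLogLength p q z.1 z.2 (inputAt q z.1 z.2 ((e k : ℚ) : ℝ))
  have hf : ∀ k, Measurable (f k) := fun k => measurable_expLogLength hq p _
  have hmax : ∀ z, ∃ k, ∀ j, f j z ≤ f k z := by
    intro z
    obtain ⟨_, ⟨k, rfl⟩, hk⟩ := Set.exists_max_image
      (range fun k => inputAt q z.1 z.2 ((e k : ℚ) : ℝ)) (expLogLength p q z.1 z.2)
      (Set.toFinite _) (range_nonempty _)
    exact ⟨k, fun j => hk _ ⟨j, rfl⟩⟩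
  -- The rule takes the first maximizer in an enumeration of the rationals of `[0,1]`; being first
  -- is a countable condition, hence measurable.
  refine ⟨fun s a => ((e (Nat.find (hmax (s, a))) : ℚ) : ℝ), ?_, ?_, ?_⟩
  · refine Measurable.find (f := fun k (_ : ℝ × ℝ) => ((e k : ℚ) : ℝ))
      (p := fun k z => ∀ j, f j z ≤ f k z) (fun _ => measurable_const) (fun k => ?_) hmax
    simp only [ofPred_forall]
    exact MeasurableSet.iInter fun j => measurableSet_le (hf j) (hf k)
  · exact fun s _ a _ => (e _).2
  · intro s hs a _ v hv
    obtain ⟨r, hr, hrv⟩ := exists_rat_inputAt_eq (a := a) hq hs.1 hv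
    obtain ⟨j, hj⟩ := he ⟨r, hr⟩
    have h := Nat.find_spec (hmax (s, a)) j
    simp only [f, hj, hrv] at h
    exact h

end RuleExistence

/-! ### A symbol that makes another one unlikely -/

section Informative

variable {𝒳 𝒴 : Type*} [Fintype 𝒳] [Fintype 𝒴] {p : 𝒳 → 𝒴 → ℝ} {q : 𝒳 → ℝ}

/-- The `q`-average over `x` of these sums is `1`, while the term `x = x₁` exceeds `1`; some other
term must then be smaller. -/
lemma exists_sum_mul_likRatio_lt_one (hp : IsChannel p) (hq : q ∈ stdSimplex ℝ 𝒳) {x₁ : 𝒳}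
    (hx₁ : 0 < q x₁) (hne : ∃ y, p x₁ y ≠ outputPMF p q y) :
    ∃ x, 0 < q x ∧ ∑ y, p x y * likRatio p q x₁ y < 1 := by
  have hp0 : ∀ y, outputPMF p q y = 0 → p x₁ y = 0 := by
    intro y hy
    by_contra h
    exact (outputPMF_pos hp hq hx₁ (lt_of_le_of_ne ((hp x₁).1 y) (Ne.symm h))).ne' hy
  have havg : ∑ x, q x * ∑ y, p x y * likRatio p q x₁ y = 1 := by
    simp_rw [Finset.mul_sum]
    rw [Finset.sum_comm, ← (hp x₁).2]
    refine Finset.sum_congr rfl fun y _ => ?_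
    simp_rw [← mul_assoc]
    rw [← Finset.sum_mul, likRatio]
    change outputPMF p q y * _ = _
    by_cases hy : outputPMF p q y = 0
    · simp [hy, hp0 y hy]
    · field_simp
  have hgt : 1 < ∑ y, p x₁ y * likRatio p q x₁ y := by
    -- The excess over `1` is the chi-square divergence of `p x₁` from the output pmf.
    have h1 : ∑ y, p x₁ y * likRatio p q x₁ y - 1 =
        ∑ y, (p x₁ y - outputPMF p q y) ^ 2 / outputPMF p q y := by
      have h2 : (1 : ℝ) = ∑ y, (2 * p x₁ y - outputPMF p q y) := by
        rw [Finset.sum_sub_distrib, ← Finset.mul_sum, (hp x₁).2, sum_outputPMF hp hq]; norm_num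
      rw [h2, ← Finset.sum_sub_distrib]
      refine Finset.sum_congr rfl fun y _ => ?_
      rw [likRatio]
      by_cases hy : outputPMF p q y = 0
      · simp [hy, hp0 y hy]
      · field_simp; ring
    rw [← sub_pos, h1]
    obtain ⟨y, hy⟩ := hne
    refine Finset.sum_pos' (fun y _ => div_nonneg (sq_nonneg _) (outputPMF_nonneg hp hq y))
      ⟨y, Finset.mem_univ y, div_pos (by have := sub_ne_zero.mpr hy; positivity) ?_⟩
    refine lt_of_le_of_ne (outputPMF_nonneg hp hq y) fun h0 => hy ?_
    rw [← h0, hp0 y h0.symm]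
  by_contra! h
  have h1 : ∑ x, q x * (∑ y, p x y * likRatio p q x₁ y - 1) = 0 := by
    simp_rw [mul_sub, Finset.sum_sub_distrib]
    rw [havg]
    simp [hq.2]
  have h2 := (Finset.sum_eq_zero_iff_of_nonneg (fun x _ => by
    rcases (hq.1 x).eq_or_lt with h0 | h0
    · simp [← h0]
    · exact mul_nonneg h0.le (sub_nonneg.mpr (h x h0)))).mp h1 x₁ (Finset.mem_univ _)
  rcases mul_eq_zero.mp h2 with h3 | h3 <;> linarith

end Informative

/-! ### Lower bounds for the mean information gain -/

section GainLowerBound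

open InformationTheory

variable {𝒳 𝒴 : Type*} [Fintype 𝒳] [LinearOrder 𝒳] {p : 𝒳 → 𝒴 → ℝ} {q : 𝒳 → ℝ}

lemma quantile_fract_of_mem {q : 𝒳 → ℝ} [Nonempty 𝒳] (hq : q ∈ stdSimplex ℝ 𝒳) {x : 𝒳} {z : ℝ}
    (h1 : cdfLT q x < z) (h2 : z < cdf q x) : quantile q (Int.fract z) = x := by
  have h0 := cdfLT_nonneg hq.1 x
  have h3 := cdf_le_one hq x
  rw [Int.fract_eq_self.mpr ⟨by linarith, by linarith⟩, quantile_eq_iff hq ⟨by linarith, by linarith⟩]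
  exact ⟨h1, h2.le⟩

lemma exists_pos_pair {q : 𝒳 → ℝ} (hq : q ∈ stdSimplex ℝ 𝒳) (hq1 : ∀ x, q x ≠ 1) :
    ∃ x₁ x₂, x₁ ≠ x₂ ∧ 0 < q x₁ ∧ 0 < q x₂ := by
  obtain ⟨x₁, h₁, -⟩ := exists_le_cdf hq zero_le_one
  refine ⟨x₁, ?_⟩
  by_contra! h
  have h2 : ∀ x, x ≠ x₁ → q x = 0 := fun x hx => le_antisymm (h x (Ne.symm hx) h₁) (hq.1 x)
  have h3 := hq.2
  rw [Finset.sum_eq_single x₁ (fun x _ hx => h2 x hx) (by simp)] at h3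
  exact hq1 x₁ h3

lemma arcMass_div_of_const [Nonempty 𝒳] (hq : q ∈ stdSimplex ℝ 𝒳) {s a : ℝ} {x : 𝒳} (hs : 0 < s)
    (h : ∀ z ∈ Icc a (a + s), quantile q (Int.fract z) = x) (y : 𝒴) :
    arcMass p q y s a / s = likRatio p q x y := by
  rw [arcMass_eq hq]
  simp_rw [occ_of_const hs.le fun z hz => h z ⟨hz.1.le, hz.2.le⟩]
  simp [hs.ne']

variable [Fintype 𝒴]

/-- Some input symbol of positive probability is informative. -/
lemma exists_ne_outputPMF (hred : NoRedundantInputs p) (hq : q ∈ stdSimplex ℝ 𝒳)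
    (hq1 : ∀ x, q x ≠ 1) : ∃ x, 0 < q x ∧ ∃ y, p x y ≠ outputPMF p q y := by
  by_contra! h
  obtain ⟨x₁, x₂, hne, h₁, h₂⟩ := exists_pos_pair hq hq1
  exact hred x₁ x₂ hne fun y => (h x₁ h₁ y).trans (h x₂ h₂ y).symm

variable [Nonempty 𝒳]

/-- Information gain when the complement of the arc, of length `ε`, lies inside one symbol. -/
lemma exists_infoGain_ge_of_near_one (hp : IsChannel p) (hred : NoRedundantInputs p)
    (hq : q ∈ stdSimplex ℝ 𝒳) (hq1 : ∀ x, q x ≠ 1) :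
    ∃ x₁, 0 < q x₁ ∧ ∃ κ > 0, ∃ ε₀ > 0, ∀ ε ∈ Ioc 0 ε₀, ∀ a ∈ Ioo (cdfLT q x₁ + ε) (cdf q x₁),
      ∀ x, IsBestSymbol p q (1 - ε) a x → κ * ε ≤ infoGain p q (1 - ε) a x := by
  obtain ⟨x₁, hx₁, hne⟩ := exists_ne_outputPMF hred hq hq1
  obtain ⟨x₂, hx₂, hlt⟩ := exists_sum_mul_likRatio_lt_one hp hq hx₁ hne
  set D := likRatioBound p q with hD
  have hD1 : 1 ≤ D := one_le_likRatioBound hp hq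
  set A := ∑ y, p x₂ y * likRatio p q x₁ y with hA
  -- The gain from `x₂` is `ε(1 - A)` up to an error `2ε²D²`. The three bounds on `ε` keep `x₂` on
  -- the arc, keep `ε` times the likelihood ratio below `1/2` for the logarithm, and make the error
  -- at most half of the main term.
  refine ⟨x₁, hx₁, (1 - A) / 2, by linarith, min (q x₂ / 2) (min (1 / (2 * D)) ((1 - A) / (4 * D ^ 2))),
    by have : 0 < 1 - A := by linarith
       positivity, ?_⟩
  intro ε hε a ha x hx
  have hε0 := hε.1
  have hε1 : ε ≤ q x₂ / 2 := hε.2.trans (min_le_left _ _)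
  have hε2 : ε * D ≤ 1 / 2 := by
    have := hε.2.trans ((min_le_right _ _).trans (min_le_left _ _))
    rw [le_div_iff₀ (by positivity)] at this
    linarith
  have hε3 : ε * D ^ 2 ≤ (1 - A) / 4 := by
    have := hε.2.trans ((min_le_right _ _).trans (min_le_right _ _))
    rw [le_div_iff₀ (by positivity)] at this
    linarith
  have hεhalf : ε ≤ 1 / 2 := by nlinarith
  have hs : 1 - ε ∈ Ioc (0 : ℝ) 1 := ⟨by linarith, by linarith⟩
  have hocc : ∀ x', occ q x' (1 - ε) a = q x' - if x₁ = x' then ε else 0 := by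
    intro x'
    have h1 := occ_add q x' (1 - ε) ε a
    rw [sub_add_cancel, occ_one hq, occ_of_const (x := x₁) hε0.le] at h1
    · linarith
    -- The complement, moved back one turn, is `[a - ε, a]`, which lies inside the interval of `x₁`.
    · intro z hz
      have h2 : Int.fract z = Int.fract (z - 1) := by simp
      rw [h2]
      exact quantile_fract_of_mem hq (by linarith [ha.1, hz.1]) (by linarith [ha.2, hz.2])
  have hpos : 0 < occ q x₂ (1 - ε) a := by
    rw [hocc]; split_ifs <;> linarith
  refine le_trans ?_ (hx.infoGain_le hp hq hs hpos)
  have hmass : ∀ y, 0 < p x₂ y → arcMass p q y (1 - ε) a = 1 - ε * likRatio p q x₁ y := by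
    intro y hy
    rw [arcMass_eq hq]
    simp_rw [hocc, sub_mul, Finset.sum_sub_distrib]
    rw [sum_mul_likRatio (outputPMF_pos hp hq hx₂ hy).ne']
    simp
  have hlogs : ε ≤ - Real.log (1 - ε) := by
    have := Real.log_le_sub_one_of_pos hs.1
    linarith
  have hterm : ∀ y, p x₂ y * (ε - ε * likRatio p q x₁ y - 2 * ε ^ 2 * D ^ 2) ≤
      p x₂ y * Real.log (arcMass p q y (1 - ε) a / (1 - ε)) := by
    intro y
    rcases ((hp x₂).1 y).eq_or_lt with h0 | h0
    · simp [← h0]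
    refine mul_le_mul_of_nonneg_left ?_ h0.le
    have hl0 := likRatio_nonneg hp hq x₁ y
    have hl1 := likRatio_le_bound hp hq x₁ y
    set t := ε * likRatio p q x₁ y with ht
    have ht0 : 0 ≤ t := by positivity
    have ht1 : t ≤ ε * D := mul_le_mul_of_nonneg_left hl1 hε0.le
    have hpos1 : 0 < 1 - t := by linarith
    rw [hmass y h0, Real.log_div hpos1.ne' hs.1.ne']
    have h3 := Real.one_sub_inv_le_log_of_pos hpos1
    have h4 : -t - 2 * t ^ 2 ≤ 1 - (1 - t)⁻¹ := by
      rw [← sub_nonneg]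
      have : 1 - (1 - t)⁻¹ - (-t - 2 * t ^ 2) = t ^ 2 * (1 - 2 * t) / (1 - t) := by
        field_simp; ring
      rw [this]
      exact div_nonneg (mul_nonneg (sq_nonneg _) (by linarith)) hpos1.le
    have h5 : t ^ 2 ≤ ε ^ 2 * D ^ 2 := by rw [← mul_pow]; exact pow_le_pow_left₀ ht0 ht1 2
    linarith
  refine le_trans ?_ (Finset.sum_le_sum fun y _ => hterm y)
  have hsum : ∑ y, p x₂ y * (ε - ε * likRatio p q x₁ y - 2 * ε ^ 2 * D ^ 2) =
      ε - ε * A - 2 * ε ^ 2 * D ^ 2 := by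
    have h1 : ∀ y, p x₂ y * (ε - ε * likRatio p q x₁ y - 2 * ε ^ 2 * D ^ 2) =
      p x₂ y * (ε - 2 * ε ^ 2 * D ^ 2) - ε * (p x₂ y * likRatio p q x₁ y) := fun y => by ring
    simp_rw [h1, Finset.sum_sub_distrib]
    rw [← Finset.sum_mul, ← Finset.mul_sum, (hp x₂).2]
    ring
  rw [hsum]
  nlinarith

/-- An arc that is neither empty nor the full circle is informative at some position. -/
lemma exists_arcDivergence_pos (hp : IsChannel p) (hred : NoRedundantInputs p)
    (hq : q ∈ stdSimplex ℝ 𝒳) (hq1 : ∀ x, q x ≠ 1) {s : ℝ} (hs : s ∈ Ioo (0 : ℝ) 1) :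
    ∃ a ∈ Icc (0 : ℝ) 1, 0 < arcDivergence p q s a := by
  by_contra! h
  have hs' : s ∈ Icc (0 : ℝ) 1 := ⟨hs.1.le, hs.2.le⟩
  have hmass : ∀ a ∈ Icc (0 : ℝ) 1, ∀ y, ∑ x, occ q x s a * p x y = outputPMF p q y * s := by
    intro a ha y
    rw [← outputPMF_mul_arcMass hp hq hs']
    have h0 := le_antisymm (h a ha) (arcDivergence_nonneg hp hq hs.1.le a)
    have hA : ∀ y, 0 ≤ arcMass p q y s a / s :=
      fun y => div_nonneg (arcMass_nonneg hp hq y hs.1.le a) hs.1.le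
    have h1 := (Finset.sum_eq_zero_iff_of_nonneg (fun y _ => mul_nonneg (outputPMF_nonneg hp hq y)
      (klFun_nonneg (hA y)))).mp h0 y (Finset.mem_univ y)
    rcases mul_eq_zero.mp h1 with h2 | h2
    · simp [h2]
    · rw [klFun_eq_zero_iff (hA y), div_eq_one_iff_eq hs.1.ne'] at h2
      rw [h2]
  obtain ⟨x₀, hlo, hhi⟩ := exists_cdfLT_le_lt_cdf hq (b := 0) (by simp)
  have hc1 : cdf q x₀ < 1 := by
    have h1 := cdf_eq_cdfLT_add q x₀
    have h2 := cdfLT_nonneg hq.1 x₀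
    refine lt_of_le_of_ne (cdf_le_one hq x₀) fun h3 => hq1 x₀ (by linarith)
  -- The arc starting at `α` begins inside the first positive symbol `x₀` and ends at or beyond its
  -- right end without passing `1`, hence within another symbol `x₁`.
  set α := max 0 (cdf q x₀ - s) with hα
  have hα0 : 0 ≤ α := le_max_left _ _
  have hαc : α < cdf q x₀ := max_lt hhi (by linarith [hs.1])
  have hβ : cdf q x₀ ≤ α + s := by linarith [le_max_right 0 (cdf q x₀ - s)]
  have hβ1 : α + s < 1 := by
    rcases max_cases 0 (cdf q x₀ - s) with h1 | h1 <;> rw [hα, h1.1] <;> linarith [hs.2]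
  obtain ⟨x₁, hlo₁, hhi₁⟩ := exists_cdfLT_le_lt_cdf hq (b := α + s) ⟨by linarith, hβ1⟩
  have hne : x₀ ≠ x₁ := by rintro rfl; linarith
  set η := min (cdf q x₀ - α) (cdf q x₁ - (α + s)) with hη
  have hη0 : 0 < η := lt_min (by linarith) (by linarith)
  have hη1 : η ≤ cdf q x₀ - α := min_le_left _ _
  have hη2 : η ≤ cdf q x₁ - (α + s) := min_le_right _ _
  -- Sliding the arc by `η` trades length `η` of `x₀` for length `η` of `x₁`. If both positions give
  -- the output pmf, the rows of `x₀` and `x₁` coincide.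
  have hocc : ∀ x, occ q x s (α + η) + (if x₀ = x then η else 0) =
      occ q x s α + if x₁ = x then η else 0 := by
    intro x
    rw [← occ_of_const (q := q) (x := x₀) (s := η) (a := α) hη0.le,
      ← occ_of_const (q := q) (x := x₁) (s := η) (a := α + s) hη0.le, add_comm, ← occ_add, ← occ_add,
      add_comm]
    · exact fun z hz => quantile_fract_of_mem hq (by linarith [hz.1]) (by linarith [hz.2])
    · exact fun z hz => quantile_fract_of_mem hq (by linarith [hz.1]) (by linarith [hz.2])
  refine hred x₀ x₁ hne fun y => ?_
  have h1 := hmass α ⟨hα0, by linarith⟩ y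
  have h2 := hmass (α + η) ⟨by linarith, by linarith⟩ y
  have h3 : ∑ x, (occ q x s (α + η) + (if x₀ = x then η else 0)) * p x y =
      ∑ x, (occ q x s α + if x₁ = x then η else 0) * p x y := by simp_rw [hocc]
  simp_rw [add_mul, Finset.sum_add_distrib] at h3
  rw [h1, h2] at h3
  simp only [ite_mul, zero_mul, Finset.sum_ite_eq, Finset.mem_univ, if_true, add_right_inj] at h3
  exact mul_left_cancel₀ hη0.ne' h3

/-- Away from the finitely many jumps of the cdf and from `0`, a short enough arc stays within one
symbol. -/
lemma ae_eventually_quantile_const (hq : q ∈ stdSimplex ℝ 𝒳) :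
    ∀ᵐ a ∂(volume.restrict (Ico (0 : ℝ) 1)), ∀ᶠ s in 𝓝[>] (0 : ℝ),
      ∀ z ∈ Icc a (a + s), quantile q (Int.fract z) = quantile q a := by
  have hfin : (insert 0 (range (cdf q))).Finite := (Set.finite_range _).insert 0
  have h1 : ∀ᵐ a : ℝ, a ∉ insert 0 (range (cdf q)) := by
    exact measure_eq_zero_iff_ae_notMem.mp (hfin.measure_zero volume)
  filter_upwards [ae_restrict_mem measurableSet_Ico, ae_restrict_of_ae h1] with a ha hna
  have ha0 : 0 < a := lt_of_le_of_ne ha.1 fun h => hna (by simp [← h])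
  have h2 := (quantile_eq_iff hq ⟨ha0, ha.2.le⟩ (x := quantile q a)).mp rfl
  have h3 : a < cdf q (quantile q a) :=
    lt_of_le_of_ne h2.2 fun h => hna (mem_insert_of_mem _ ⟨_, h.symm⟩)
  filter_upwards [Ioo_mem_nhdsGT (sub_pos.mpr h3)] with s hs z hz
  exact quantile_fract_of_mem hq (h2.1.trans_le hz.1) (by linarith [hz.2, hs.2])

lemma continuousOn_arcDivergence (hq : q ∈ stdSimplex ℝ 𝒳) :
    ContinuousOn (fun z : ℝ × ℝ => arcDivergence p q z.1 z.2) {z | z.1 ≠ 0} := by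
  unfold arcDivergence
  have h1 := fun y => continuous_arcMass hq p y
  have h2 := continuous_klFun
  refine continuousOn_finsetSum _ fun y _ => continuousOn_const.mul ?_
  exact h2.comp_continuousOn ((h1 y).continuousOn.div continuousOn_fst fun z hz => hz)

lemma continuous_arcDivergence_right (hq : q ∈ stdSimplex ℝ 𝒳) {s : ℝ} (hs : s ≠ 0) :
    Continuous (arcDivergence p q s) :=
  (continuousOn_arcDivergence hq).comp_continuous (f := fun a => (s, a)) (by fun_prop) fun _ => hs

/-- The relative entropy of a short arc is bounded below on average. -/
lemma eventually_integral_arcDivergence_ge (hp : IsChannel p) (hred : NoRedundantInputs p)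
    (hq : q ∈ stdSimplex ℝ 𝒳) (hq1 : ∀ x, q x ≠ 1) :
    ∃ c > 0, ∀ᶠ s in 𝓝[>] (0 : ℝ), c ≤ ∫ a in Ico (0 : ℝ) 1, arcDivergence p q s a := by
  set F : 𝒳 → ℝ := fun x => ∑ y, outputPMF p q y * klFun (likRatio p q x y) with hF
  have hFnn : ∀ x y, 0 ≤ outputPMF p q y * klFun (likRatio p q x y) := fun x y =>
    mul_nonneg (outputPMF_nonneg hp hq y) (klFun_nonneg (likRatio_nonneg hp hq x y))
  have hpos : 0 < ∑ x, q x * F x := by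
    obtain ⟨x, hx, y, hy⟩ := exists_ne_outputPMF hred hq hq1
    refine Finset.sum_pos' (fun x _ => mul_nonneg (hq.1 x) (Finset.sum_nonneg fun y _ => hFnn x y))
      ⟨x, Finset.mem_univ x, mul_pos hx (Finset.sum_pos' (fun y _ => hFnn x y)
        ⟨y, Finset.mem_univ y, lt_of_le_of_ne (hFnn x y) fun h => hy ?_⟩)⟩
    by_cases h0 : outputPMF p q y = 0
    · rw [h0]
      by_contra h1
      exact (outputPMF_pos hp hq hx (lt_of_le_of_ne ((hp x).1 y) (Ne.symm h1))).ne' h0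
    · have h1 := (mul_eq_zero.mp h.symm).resolve_left h0
      rwa [klFun_eq_zero_iff (likRatio_nonneg hp hq x y), likRatio, div_eq_one_iff_eq h0] at h1
  obtain ⟨C, hC⟩ := (isCompact_Icc (a := 0) (b := likRatioBound p q)).exists_bound_of_continuousOn
    continuous_klFun.continuousOn
  have hlim : Tendsto (fun s => ∫ a in Ico (0 : ℝ) 1, arcDivergence p q s a) (𝓝[>] 0)
      (𝓝 (∫ a in Ico (0 : ℝ) 1, F (quantile q a))) := by
    refine tendsto_integral_filter_of_dominated_convergence
      (fun _ => ∑ y, outputPMF p q y * C) ?_ ?_ (integrable_const _) ?_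
    · filter_upwards [self_mem_nhdsWithin] with s hs
      exact (continuous_arcDivergence_right hq (ne_of_gt hs)).aestronglyMeasurable
    · filter_upwards [self_mem_nhdsWithin] with s hs
      have hs : 0 < s := hs
      refine ae_of_all _ fun a => ?_
      refine (norm_sum_le _ _).trans (Finset.sum_le_sum fun y _ => ?_)
      rw [norm_mul, Real.norm_of_nonneg (outputPMF_nonneg hp hq y)]
      refine mul_le_mul_of_nonneg_left (hC _ ⟨?_, ?_⟩) (outputPMF_nonneg hp hq y)
      · exact div_nonneg (arcMass_nonneg hp hq y hs.le a) hs.le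
      · rw [div_le_iff₀ hs, mul_comm]
        exact arcMass_le hp hq hs.le a y
    · filter_upwards [ae_eventually_quantile_const hq] with a ha
      refine tendsto_const_nhds.congr' ?_
      filter_upwards [ha, self_mem_nhdsWithin] with s h1 hs
      simp only [arcDivergence, hF, arcMass_div_of_const hq hs h1]
  rw [integral_Ico_eq_integral_Ioo, ← integral_Ioc_eq_integral_Ioo,
    ← intervalIntegral.integral_of_le zero_le_one, integral_comp_quantile hq F] at hlim
  exact ⟨(∑ x, q x * F x) / 2, by linarith,
    (hlim.eventually (lt_mem_nhds (by linarith))).mono fun s hs => hs.le⟩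

/-- The relative entropy of an arc is bounded below on average, away from the full circle. -/
lemma exists_integral_arcDivergence_ge (hp : IsChannel p) (hred : NoRedundantInputs p)
    (hq : q ∈ stdSimplex ℝ 𝒳) (hq1 : ∀ x, q x ≠ 1) {b : ℝ} (hb : b < 1) :
    ∃ c > 0, ∀ s ∈ Ioc 0 b, c ≤ ∫ a in Ico (0 : ℝ) 1, arcDivergence p q s a := by
  obtain ⟨c₁, hc₁, h₁⟩ := eventually_integral_arcDivergence_ge hp hred hq hq1
  obtain ⟨s₀, hs₀, h₁⟩ := mem_nhdsGT_iff_exists_Ioo_subset.mp h₁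
  have hs₀ : 0 < s₀ := hs₀
  -- The truncation `max s s₀` keeps the divisor away from zero, so `H` is continuous on the whole
  -- line.
  set H : ℝ → ℝ := fun s => ∫ a in (0 : ℝ)..1, arcDivergence p q (max s s₀) a with hH
  have hcont : Continuous H := by
    refine intervalIntegral.continuous_parametric_intervalIntegral_of_continuous' ?_ _ _
    exact (continuousOn_arcDivergence hq).comp_continuous
      (f := fun z : ℝ × ℝ => (max z.1 s₀, z.2)) (by fun_prop)
      fun z => (hs₀.trans_le (le_max_right _ _)).ne'
  have hHeq : ∀ s, s₀ ≤ s → H s = ∫ a in Ico (0 : ℝ) 1, arcDivergence p q s a := by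
    intro s hs
    rw [hH]
    simp only [max_eq_left hs]
    rw [intervalIntegral.integral_of_le zero_le_one, integral_Ioc_eq_integral_Ioo,
      integral_Ico_eq_integral_Ioo]
  have hHpos : ∀ s ∈ Icc s₀ b, 0 < H s := by
    intro s hs
    simp only [hH, max_eq_left hs.1]
    have hs0 : 0 < s := hs₀.trans_le hs.1
    exact intervalIntegral.integral_pos one_pos
      (continuous_arcDivergence_right hq hs0.ne').continuousOn
      (fun a _ => arcDivergence_nonneg hp hq hs0.le a)
      (exists_arcDivergence_pos hp hred hq hq1 ⟨hs0, hs.2.trans_lt hb⟩)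
  have hsmall : ∀ s ∈ Ioo 0 s₀, c₁ ≤ ∫ a in Ico (0 : ℝ) 1, arcDivergence p q s a := fun s hs => h₁ hs
  rcases (Icc s₀ b).eq_empty_or_nonempty with hemp | hne
  · refine ⟨c₁, hc₁, fun s hs => hsmall s ⟨hs.1, ?_⟩⟩
    by_contra! h
    exact hemp.subset (⟨h, hs.2⟩ : s ∈ Icc s₀ b)
  · obtain ⟨s₁, hs₁, hmin⟩ := isCompact_Icc.exists_isMinOn hne hcont.continuousOn
    refine ⟨min c₁ (H s₁), lt_min hc₁ (hHpos s₁ hs₁), fun s hs => ?_⟩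
    rcases lt_or_ge s s₀ with h | h
    · exact (min_le_left _ _).trans (hsmall s ⟨hs.1, h⟩)
    · rw [← hHeq s h]
      exact (min_le_right _ _).trans (hmin (⟨h, hs.2⟩ : s ∈ Icc s₀ b))

/-- The average information gain is at least of the order of `1 - s`. -/
lemma exists_integral_infoGain_ge (hp : IsChannel p) (hred : NoRedundantInputs p)
    (hq : q ∈ stdSimplex ℝ 𝒳) (hq1 : ∀ x, q x ≠ 1) :
    ∃ c > 0, ∀ s ∈ Ioo (0 : ℝ) 1, ∃ g : ℝ → ℝ, IntegrableOn g (Ico 0 1) ∧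
      c * (1 - s) ≤ ∫ a in Ico (0 : ℝ) 1, g a ∧
      ∀ a x, IsBestSymbol p q s a x → g a ≤ infoGain p q s a x := by
  obtain ⟨x₁, hx₁, κ, hκ, ε₀, hε₀, hnear⟩ := exists_infoGain_ge_of_near_one hp hred hq hq1
  set ε₁ := min ε₀ (q x₁ / 2) with hε₁
  have hε₁0 : 0 < ε₁ := lt_min hε₀ (by linarith)
  obtain ⟨c, hc, hfar⟩ := exists_integral_arcDivergence_ge hp hred hq hq1
    (b := 1 - ε₁) (by linarith)
  refine ⟨min c (κ * (q x₁ / 2)), by positivity, fun s hs => ?_⟩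
  have hs' : s ∈ Ioc (0 : ℝ) 1 := ⟨hs.1, hs.2.le⟩
  have h1s : 0 < 1 - s := by linarith [hs.2]
  -- Far from the full circle the relative entropy is a sufficient minorant. Near it, the linear
  -- gain is used for starting points that put the complement inside `x₁`, a set of measure at least
  -- `q x₁ / 2`; elsewhere the gain is nonnegative.
  rcases le_or_gt s (1 - ε₁) with h | h
  · refine ⟨arcDivergence p q s, ?_, ?_, fun a x hx => hx.arcDivergence_le hp hq hs'⟩
    · exact ((continuous_arcDivergence_right hq hs.1.ne').integrableOn_Icc (a := 0) (b := 1)).mono_set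
        Ico_subset_Icc_self
    · refine le_trans ?_ (hfar s ⟨hs.1, h⟩)
      calc min c (κ * (q x₁ / 2)) * (1 - s) ≤ c * 1 :=
            mul_le_mul (min_le_left _ _) (by linarith [hs.1]) h1s.le hc.le
        _ = c := mul_one c
  · have h2 : 1 - s ≤ ε₀ := by linarith [min_le_left ε₀ (q x₁ / 2)]
    have h3 : 1 - s ≤ q x₁ / 2 := by linarith [min_le_right ε₀ (q x₁ / 2)]
    have h4 := cdf_eq_cdfLT_add q x₁
    have h5 := cdfLT_nonneg hq.1 x₁
    have h6 := cdf_le_one hq x₁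
    have hsub : Ioo (cdfLT q x₁ + (1 - s)) (cdf q x₁) ⊆ Ico 0 1 := fun a ha =>
      ⟨by linarith [ha.1], by linarith [ha.2]⟩
    refine ⟨(Ioo (cdfLT q x₁ + (1 - s)) (cdf q x₁)).indicator fun _ => κ * (1 - s), ?_, ?_, ?_⟩
    · exact (integrableOn_const (by simp)).indicator measurableSet_Ioo
    · rw [setIntegral_indicator measurableSet_Ioo, inter_eq_self_of_subset_right hsub]
      simp only [integral_const, MeasurableSet.univ, measureReal_restrict_apply, univ_inter,
        Real.volume_real_Ioo, smul_eq_mul]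
      rw [max_eq_left (by linarith)]
      calc min c (κ * (q x₁ / 2)) * (1 - s) ≤ κ * (q x₁ / 2) * (1 - s) :=
            mul_le_mul_of_nonneg_right (min_le_right _ _) h1s.le
        _ = (q x₁ / 2) * (κ * (1 - s)) := by ring
        _ ≤ _ := mul_le_mul_of_nonneg_right (by linarith) (by positivity)
    · intro a x hx
      by_cases ha : a ∈ Ioo (cdfLT q x₁ + (1 - s)) (cdf q x₁)
      · rw [indicator_of_mem ha]
        have := hnear (1 - s) ⟨h1s, h2⟩ a ha x
        rw [sub_sub_cancel] at this
        exact this hx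
      · rw [indicator_of_notMem ha]
        exact (arcDivergence_nonneg hp hq hs.1.le a).trans (hx.arcDivergence_le hp hq hs')

end GainLowerBound

/-! ### One-step moment generating functions -/

section MomentGeneratingFunction

variable {𝒳 𝒴 : Type*} [Fintype 𝒳] [LinearOrder 𝒳] [Nonempty 𝒳] [Fintype 𝒴]
  {p : 𝒳 → 𝒴 → ℝ} {q : 𝒳 → ℝ} {V : ℝ → ℝ → ℝ}

lemma IsMaxInfoGainRule.measurable_comp_inputAt {β : Type*} [MeasurableSpace β]
    (hV : IsMaxInfoGainRule p q V) (h : 𝒳 → β) :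
    Measurable fun z : ℝ × ℝ => h (inputAt q z.1 z.2 (V z.1 z.2)) :=
  (measurable_comp_quantile q h).comp (measurable_fract.comp
    ((hV.measurable.mul measurable_fst).add measurable_snd))

/-- Conditional expectation of `(S' / s) ^ (-ρ)` when `x` is sent. -/
lemma IsBestSymbol.sum_ofReal_mul_rpow (hp : IsChannel p) (hq : q ∈ stdSimplex ℝ 𝒳) {s a : ℝ}
    {x : 𝒳} (hs : s ∈ Ioc (0 : ℝ) 1) (hx : IsBestSymbol p q s a x) (ρ : ℝ) :
    ∑ y, ENNReal.ofReal (p x y) * ENNReal.ofReal (arcMass p q y s a / s) ^ (-ρ) =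
      ENNReal.ofReal (∑ y, p x y * (arcMass p q y s a / s) ^ (-ρ)) := by
  rw [ENNReal.ofReal_sum_of_nonneg fun y _ => mul_nonneg ((hp x).1 y) (Real.rpow_nonneg
    (div_nonneg (arcMass_nonneg hp hq y hs.1.le a) hs.1.le) _)]
  refine Finset.sum_congr rfl fun y _ => ?_
  rcases ((hp x).1 y).eq_or_lt with h | h
  · simp [← h]
  · rw [ENNReal.ofReal_mul h.le,
      ENNReal.ofReal_rpow_of_pos (div_pos (hx.arcMass_pos hp hq hs h) hs.1)]

lemma exp_mul_neg_le {l ρ b : ℝ} (hb : |l * ρ| ≤ b) (hb1 : b ≤ 1) :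
    Real.exp (l * -ρ) ≤ 1 - ρ * l + b ^ 2 := by
  have h := Real.abs_exp_sub_one_sub_id_le (x := l * -ρ) (by
    rw [mul_neg, abs_neg]; exact hb.trans hb1)
  have h1 := (abs_le.mp h).2
  have h2 : (l * -ρ) ^ 2 ≤ b ^ 2 := by
    rw [mul_neg, neg_sq, ← sq_abs]
    exact pow_le_pow_left₀ (abs_nonneg _) hb 2
  linarith

/-- The moment generating functions of the scheme are bounded away from one. -/
lemma Psi_lt_one (hp : IsChannel p) (hred : NoRedundantInputs p) (hq : q ∈ stdSimplex ℝ 𝒳)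
    (hq1 : ∀ x, q x ≠ 1) (hV : IsMaxInfoGainRule p q V) : Psi p q V < 1 := by
  obtain ⟨B, hB, hlog⟩ := exists_abs_log_le hp hq
  obtain ⟨c, hc, hgain⟩ := exists_integral_infoGain_ge hp hred hq hq1
  -- The first bound gives `ρ |log| ≤ rB ≤ 1`, as the expansion of the exponential requires; the
  -- second makes the quadratic term `(rB)²` at most half of the linear gain `rc`.
  set r := min (1 / B) (c / (2 * B ^ 2)) with hr
  have hr0 : 0 < r := by positivity
  have hr1 : r * B ≤ 1 := by
    have := min_le_left (1 / B) (c / (2 * B ^ 2))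
    rwa [← hr, le_div_iff₀ hB] at this
  have hr2 : r * B ^ 2 ≤ c / 2 := by
    have := min_le_right (1 / B) (c / (2 * B ^ 2))
    rw [← hr, le_div_iff₀ (by positivity)] at this
    linarith
  refine lt_of_le_of_lt (b := ENNReal.ofReal (1 - r * c / 2)) ?_
    (by rw [← ENNReal.ofReal_one]; exact (ENNReal.ofReal_lt_ofReal_iff one_pos).mpr
          (by have := mul_pos hr0 hc; linarith))
  refine iInf_le_of_le (fun s => r / (1 - s)) (iInf_le_of_le ?_ (iInf_le_of_le ?_ ?_))
  · intro s hs t ht hst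
    exact div_le_div_of_nonneg_left hr0.le (by linarith [ht.2]) (by linarith)
  · exact fun s hs => div_nonneg hr0.le (by linarith [hs.2])
  refine iSup₂_le fun s hs => ?_
  have hs' : s ∈ Ioc (0 : ℝ) 1 := ⟨hs.1, hs.2.le⟩
  have h1s : 0 < 1 - s := by linarith [hs.2]
  obtain ⟨g, hgi, hgc, hg⟩ := hgain s hs
  set ρ := r / (1 - s) with hρ
  have hρ0 : 0 ≤ ρ := div_nonneg hr0.le h1s.le
  have hρs : ρ * (1 - s) = r := div_mul_cancel₀ _ h1s.ne'
  have hpt : ∀ a ∈ Ico (0 : ℝ) 1, ∑ y, p (inputAt q s a (V s a)) y *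
      (arcMass p q y s a / s) ^ (-ρ) ≤ 1 + (r * B) ^ 2 - ρ * g a := by
    intro a ha
    have hx := hV.isBestSymbol hq hs' ha
    set x := inputAt q s a (V s a)
    have h1 : ∀ y, p x y * (arcMass p q y s a / s) ^ (-ρ) ≤
        p x y * (1 + (r * B) ^ 2) - ρ * (p x y * Real.log (arcMass p q y s a / s)) := by
      intro y
      rcases ((hp x).1 y).eq_or_lt with h | h
      · simp [← h]
      · rw [Real.rpow_def_of_pos (div_pos (hx.arcMass_pos hp hq hs' h) hs.1)]
        have h2 := hlog s hs a x hx y h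
        have h3 := exp_mul_neg_le (l := Real.log (arcMass p q y s a / s)) (ρ := ρ) (b := r * B) (by
          rw [abs_mul, abs_of_nonneg hρ0]
          calc _ ≤ B * (1 - s) * ρ := mul_le_mul_of_nonneg_right h2 hρ0
            _ = r * B := by rw [← hρs]; ring) hr1
        have h4 := mul_le_mul_of_nonneg_left h3 h.le
        linarith
    refine (Finset.sum_le_sum fun y _ => h1 y).trans ?_
    rw [Finset.sum_sub_distrib, ← Finset.sum_mul, ← Finset.mul_sum, (hp x).2, one_mul]
    have := mul_le_mul_of_nonneg_left (hg a x hx) hρ0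
    rw [infoGain] at this
    linarith
  have hnn : ∀ a ∈ Ico (0 : ℝ) 1, 0 ≤ 1 + (r * B) ^ 2 - ρ * g a := fun a ha =>
    (Finset.sum_nonneg fun y _ => mul_nonneg ((hp _).1 y) (Real.rpow_nonneg
      (div_nonneg (arcMass_nonneg hp hq y hs.1.le a) hs.1.le) _)).trans (hpt a ha)
  have hint : Integrable (fun a => 1 + (r * B) ^ 2 - ρ * g a) (volume.restrict (Ico 0 1)) :=
    (integrable_const _).sub (hgi.const_mul ρ)
  calc actualMGF p q V s ρ
      ≤ ∫⁻ a in Ico (0 : ℝ) 1, ENNReal.ofReal (1 + (r * B) ^ 2 - ρ * g a) := by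
        refine setLIntegral_mono' measurableSet_Ico fun a ha => ?_
        rw [(hV.isBestSymbol hq hs' ha).sum_ofReal_mul_rpow hp hq hs']
        exact ENNReal.ofReal_le_ofReal (hpt a ha)
    _ = ENNReal.ofReal (∫ a in Ico (0 : ℝ) 1, (1 + (r * B) ^ 2 - ρ * g a)) := by
        rw [ofReal_integral_eq_lintegral_ofReal hint]
        filter_upwards [ae_restrict_mem measurableSet_Ico] with a ha using hnn a ha
    _ ≤ ENNReal.ofReal (1 - r * c / 2) := by
        refine ENNReal.ofReal_le_ofReal ?_
        rw [integral_sub (integrable_const _) (hgi.const_mul ρ), integral_const_mul]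
        have h1 := mul_le_mul_of_nonneg_left hgc hρ0
        have h2 : ρ * (c * (1 - s)) = r * c := by rw [← hρs]; ring
        have h3 : (r * B) ^ 2 ≤ r * c / 2 := by
          calc (r * B) ^ 2 = r * (r * B ^ 2) := by ring
            _ ≤ r * (c / 2) := mul_le_mul_of_nonneg_left hr2 hr0.le
            _ = r * c / 2 := by ring
        simp
        linarith

lemma lintegral_ofReal_comp_quantile (hq : q ∈ stdSimplex ℝ 𝒳) {h : 𝒳 → ℝ} (hh : ∀ x, 0 ≤ h x) :
    ∫⁻ a in Ico (0 : ℝ) 1, ENNReal.ofReal (h (quantile q a)) =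
      ENNReal.ofReal (∑ x, q x * h x) := by
  rw [← integral_comp_quantile hq h, intervalIntegral.integral_of_le zero_le_one,
    integral_Ioc_eq_integral_Ioo, ← integral_Ico_eq_integral_Ioo,
    ofReal_integral_eq_lintegral_ofReal _ (ae_of_all _ fun a => hh _)]
  refine Integrable.of_bound (measurable_comp_quantile q h).aestronglyMeasurable (∑ x, h x)
    (ae_of_all _ fun a => ?_)
  rw [Real.norm_of_nonneg (hh _)]
  exact Finset.single_le_sum (fun x _ => hh x) (Finset.mem_univ _)

/-- For short intervals the actual moment generating function tends to the ideal one. -/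
lemma tendsto_actualMGF (hp : IsChannel p) (hq : q ∈ stdSimplex ℝ 𝒳)
    (hV : IsMaxInfoGainRule p q V) {ρ : ℝ} (hρ : 0 ≤ ρ) :
    Tendsto (fun s => actualMGF p q V s ρ) (𝓝[>] 0) (𝓝 (ENNReal.ofReal (idealMGF p q ρ))) := by
  obtain ⟨B, hB, hlog⟩ := exists_abs_log_le hp hq
  have hlim := lintegral_ofReal_comp_quantile hq
    (h := fun x => ∑ y, p x y * likRatio p q x y ^ (-ρ)) (fun x => Finset.sum_nonneg fun y _ =>
      mul_nonneg ((hp x).1 y) (Real.rpow_nonneg (likRatio_nonneg hp hq x y) _))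
  change _ = ENNReal.ofReal (idealMGF p q ρ) at hlim
  rw [← hlim]
  unfold actualMGF
  have hev : ∀ᶠ s : ℝ in 𝓝[>] 0, s ∈ Ioo (0 : ℝ) 1 := Ioo_mem_nhdsGT one_pos
  refine tendsto_lintegral_filter_of_dominated_convergence
    (fun _ => ENNReal.ofReal (Real.exp (B * ρ))) ?_ ?_ ?_ ?_
  · refine Eventually.of_forall fun s => Finset.measurable_sum _ fun y _ => ?_
    exact ((hV.measurable_comp_inputAt fun x => ENNReal.ofReal (p x y)).comp
      (measurable_const (a := s) |>.prodMk measurable_id)).mul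
      ((ENNReal.measurable_ofReal.comp (((continuous_arcMass hq p y).measurable.comp
        (measurable_const (a := s) |>.prodMk measurable_id)).div_const s)).pow_const (-ρ))
  · filter_upwards [hev] with s hs
    filter_upwards [ae_restrict_mem measurableSet_Ico] with a ha
    have hs' : s ∈ Ioc (0 : ℝ) 1 := ⟨hs.1, hs.2.le⟩
    have hx := hV.isBestSymbol hq hs' ha
    rw [hx.sum_ofReal_mul_rpow hp hq hs']
    refine ENNReal.ofReal_le_ofReal ?_
    set x := inputAt q s a (V s a)
    calc _ ≤ ∑ y, p x y * Real.exp (B * ρ) := by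
          refine Finset.sum_le_sum fun y _ => ?_
          rcases ((hp x).1 y).eq_or_lt with h | h
          · simp [← h]
          · refine mul_le_mul_of_nonneg_left ?_ h.le
            rw [Real.rpow_def_of_pos (div_pos (hx.arcMass_pos hp hq hs' h) hs.1)]
            refine Real.exp_le_exp.mpr ?_
            have h1 := neg_le_of_abs_le (hlog s hs a x hx y h)
            have h2 : B * (1 - s) ≤ B := by nlinarith [hs.1]
            nlinarith
      _ = Real.exp (B * ρ) := by rw [← Finset.sum_mul, (hp x).2, one_mul]
  · simp
  · filter_upwards [ae_eventually_quantile_const hq, ae_restrict_mem measurableSet_Ico] with a ha ha'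
    refine tendsto_const_nhds.congr' ?_
    filter_upwards [ha, hev] with s h1 hs
    have hs' : s ∈ Ioc (0 : ℝ) 1 := ⟨hs.1, hs.2.le⟩
    have hx := hV.isBestSymbol hq hs' ha'
    have hv := hV.mem s hs' a ha'
    rw [hx.sum_ofReal_mul_rpow hp hq hs']
    -- The whole short arc carries one symbol, so every choice of `V` sends it.
    have h2 : inputAt q s a (V s a) = quantile q a := h1 _
      ⟨by nlinarith [hv.1, hs.1], by nlinarith [hv.2, hs.1]⟩
    simp only [h2, arcMass_div_of_const hq hs.1 h1]

end MomentGeneratingFunction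

/-! ### The contracted function of the interval length -/

section Lyapunov

/-- Antiderivative in logarithmic scale of a nondecreasing function on `(0,1)`. -/
def logPrimitive (θ : ℝ → ℝ) (s : ℝ) : ℝ := ∫ t in s..(1 / 2 : ℝ), θ t * t⁻¹

/-- The exponential of `logPrimitive`, extended by `∞` at `0` and by `0` at `1`. -/
def expLogPrimitive (θ : ℝ → ℝ) (s : ℝ) : ℝ≥0∞ :=
  if s ≤ 0 then ⊤ else if 1 ≤ s then 0 else ENNReal.ofReal (Real.exp (logPrimitive θ s))

variable {θ : ℝ → ℝ}

lemma intervalIntegrable_mul_inv (hθ : MonotoneOn θ (Ioo 0 1)) {s t : ℝ} (hs : s ∈ Ioo (0 : ℝ) 1)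
    (ht : t ∈ Ioo (0 : ℝ) 1) : IntervalIntegrable (fun u => θ u * u⁻¹) volume s t := by
  have hsub : uIcc s t ⊆ Ioo 0 1 := ordConnected_Ioo.uIcc_subset hs ht
  refine (hθ.mono hsub).intervalIntegrable.mul_continuousOn ?_
  exact continuousOn_inv₀.mono fun u hu => (hsub hu).1.ne'

lemma logPrimitive_sub (hθ : MonotoneOn θ (Ioo 0 1)) {s t : ℝ} (hs : s ∈ Ioo (0 : ℝ) 1)
    (ht : t ∈ Ioo (0 : ℝ) 1) : logPrimitive θ t = logPrimitive θ s + ∫ u in t..s, θ u * u⁻¹ := by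
  have h : (1 / 2 : ℝ) ∈ Ioo (0 : ℝ) 1 := by norm_num
  rw [logPrimitive, logPrimitive, add_comm, intervalIntegral.integral_add_adjacent_intervals
    (intervalIntegrable_mul_inv hθ ht hs) (intervalIntegrable_mul_inv hθ hs h)]

/-- `logPrimitive θ` is a convex function of `ln s` with slope `-θ s`. -/
lemma logPrimitive_le (hθ : MonotoneOn θ (Ioo 0 1)) {s t : ℝ} (hs : s ∈ Ioo (0 : ℝ) 1)
    (ht : t ∈ Ioo (0 : ℝ) 1) :
    logPrimitive θ t ≤ logPrimitive θ s + Real.log (t / s) * (-θ s) := by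
  rw [logPrimitive_sub hθ hs ht]
  have hsub : uIcc s t ⊆ Ioo 0 1 := ordConnected_Ioo.uIcc_subset hs ht
  have hci : ∀ {a b : ℝ}, a ∈ Ioo (0 : ℝ) 1 → b ∈ Ioo (0 : ℝ) 1 →
      IntervalIntegrable (fun u => θ s * u⁻¹) volume a b := fun ha hb =>
    intervalIntegrable_mul_inv (θ := fun _ => θ s) monotoneOn_const ha hb
  -- On either side of `s`, monotonicity allows `θ u` to be replaced by `θ s` in the direction that
  -- bounds the oriented integral from above.
  rcases le_total t s with h | h
  · have h1 : ∫ u in t..s, θ u * u⁻¹ ≤ ∫ u in t..s, θ s * u⁻¹ := by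
      refine intervalIntegral.integral_mono_on h (intervalIntegrable_mul_inv hθ ht hs) (hci ht hs) ?_
      intro u hu
      have hu0 : 0 < u := ht.1.trans_le hu.1
      exact mul_le_mul_of_nonneg_right (hθ ⟨hu0, hu.2.trans_lt hs.2⟩ hs hu.2) (inv_nonneg.mpr hu0.le)
    rw [intervalIntegral.integral_const_mul, integral_inv_of_pos ht.1 hs.1,
      Real.log_div hs.1.ne' ht.1.ne'] at h1
    rw [Real.log_div ht.1.ne' hs.1.ne']
    linarith
  · have h1 : ∫ u in s..t, θ s * u⁻¹ ≤ ∫ u in s..t, θ u * u⁻¹ := by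
      refine intervalIntegral.integral_mono_on h (hci hs ht) (intervalIntegrable_mul_inv hθ hs ht) ?_
      intro u hu
      have hu0 : 0 < u := hs.1.trans_le hu.1
      exact mul_le_mul_of_nonneg_right (hθ hs ⟨hu0, hu.2.trans_lt ht.2⟩ hu.1) (inv_nonneg.mpr hu0.le)
    rw [intervalIntegral.integral_const_mul, integral_inv_of_pos hs.1 ht.1] at h1
    rw [intervalIntegral.integral_symm]
    linarith

lemma logPrimitive_anti (hθ : MonotoneOn θ (Ioo 0 1)) (hθ0 : ∀ s ∈ Ioo (0 : ℝ) 1, 0 ≤ θ s)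
    {s t : ℝ} (hs : s ∈ Ioo (0 : ℝ) 1) (ht : t ∈ Ioo (0 : ℝ) 1) (hst : s ≤ t) :
    logPrimitive θ t ≤ logPrimitive θ s := by
  have h := logPrimitive_le hθ hs ht
  have h1 : 0 ≤ Real.log (t / s) := Real.log_nonneg ((one_le_div hs.1).mpr hst)
  have h2 := mul_nonneg h1 (hθ0 s hs)
  linarith

lemma expLogPrimitive_of_mem {s : ℝ} (hs : s ∈ Ioo (0 : ℝ) 1) :
    expLogPrimitive θ s = ENNReal.ofReal (Real.exp (logPrimitive θ s)) := by
  rw [expLogPrimitive, if_neg hs.1.not_ge, if_neg hs.2.not_ge]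

lemma expLogPrimitive_antitone (hθ : MonotoneOn θ (Ioo 0 1))
    (hθ0 : ∀ s ∈ Ioo (0 : ℝ) 1, 0 ≤ θ s) : Antitone (expLogPrimitive θ) := by
  intro s t hst
  rcases le_or_gt s 0 with h0 | h0
  · simp [expLogPrimitive, h0]
  rcases le_or_gt 1 t with h1 | h1
  · simp [expLogPrimitive, h1, (h0.trans_le hst).not_ge]
  have hs : s ∈ Ioo (0 : ℝ) 1 := ⟨h0, hst.trans_lt h1⟩
  have ht : t ∈ Ioo (0 : ℝ) 1 := ⟨h0.trans_le hst, h1⟩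
  rw [expLogPrimitive_of_mem hs, expLogPrimitive_of_mem ht]
  exact ENNReal.ofReal_le_ofReal (Real.exp_le_exp.mpr (logPrimitive_anti hθ hθ0 hs ht hst))

lemma one_le_expLogPrimitive (hθ : MonotoneOn θ (Ioo 0 1))
    (hθ0 : ∀ s ∈ Ioo (0 : ℝ) 1, 0 ≤ θ s) {s : ℝ} (hs : s ≤ 1 / 2) : 1 ≤ expLogPrimitive θ s := by
  refine le_trans (le_of_eq ?_) (expLogPrimitive_antitone hθ hθ0 hs)
  rw [expLogPrimitive_of_mem (by norm_num)]
  simp [logPrimitive]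

/-- This exponentiates the tangent bound `logPrimitive_le`. The value `0` from length one on makes
the case `t ≥ 1` trivial. -/
lemma expLogPrimitive_le_mul_rpow (hθ : MonotoneOn θ (Ioo 0 1)) {s t : ℝ}
    (hs : s ∈ Ioo (0 : ℝ) 1) (ht : 0 < t) :
    expLogPrimitive θ t ≤ expLogPrimitive θ s * ENNReal.ofReal (t / s) ^ (-θ s) := by
  rcases le_or_gt 1 t with h1 | h1
  · simp [expLogPrimitive, h1, ht.not_ge]
  have hr : 0 < t / s := div_pos ht hs.1
  rw [expLogPrimitive_of_mem hs, expLogPrimitive_of_mem ⟨ht, h1⟩, ENNReal.ofReal_rpow_of_pos hr,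
    ← ENNReal.ofReal_mul (Real.exp_pos _).le, Real.rpow_def_of_pos hr, ← Real.exp_add]
  exact ENNReal.ofReal_le_ofReal (Real.exp_le_exp.mpr (logPrimitive_le hθ hs ⟨ht, h1⟩))

/-- The tangent at the single point `s₀` controls all shorter lengths, so `θ` need be at most `ρ`
only there. -/
lemma exists_expLogPrimitive_le (hθ : MonotoneOn θ (Ioo 0 1)) {s₀ ρ : ℝ} (hs₀ : s₀ ∈ Ioo (0 : ℝ) 1)
    (hρ : θ s₀ ≤ ρ) :
    ∃ A, ∀ s ∈ Ioo 0 s₀, expLogPrimitive θ s ≤ ENNReal.ofReal (A * s ^ (-ρ)) := by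
  refine ⟨Real.exp (logPrimitive θ s₀ + Real.log s₀ * ρ), fun s hs => ?_⟩
  have hs1 : s ∈ Ioo (0 : ℝ) 1 := ⟨hs.1, hs.2.trans hs₀.2⟩
  rw [expLogPrimitive_of_mem hs1, Real.rpow_def_of_pos hs.1, ← Real.exp_add]
  refine ENNReal.ofReal_le_ofReal (Real.exp_le_exp.mpr ?_)
  have h1 := logPrimitive_le hθ hs₀ hs1
  rw [Real.log_div hs.1.ne' hs₀.1.ne'] at h1
  have h2 := Real.log_le_log hs.1 hs.2.le
  nlinarith

variable {𝒳 𝒴 : Type*} [Fintype 𝒳] [LinearOrder 𝒳] [Nonempty 𝒳] [Fintype 𝒴]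
  {p : 𝒳 → 𝒴 → ℝ} {q : 𝒳 → ℝ} {V : ℝ → ℝ → ℝ}

/-- One step of the scheme contracts `expLogPrimitive θ` on average, if the moment generating
functions at `θ s` are at most `K`. -/
lemma lintegral_expLogPrimitive_le (hp : IsChannel p) (hq : q ∈ stdSimplex ℝ 𝒳)
    (hV : IsMaxInfoGainRule p q V) (hθ : MonotoneOn θ (Ioo 0 1)) {K : ℝ} (hK : 0 < K)
    (hmgf : ∀ s ∈ Ioo (0 : ℝ) 1, actualMGF p q V s (θ s) ≤ ENNReal.ofReal K) {s : ℝ}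
    (hs : s ∈ Icc (0 : ℝ) 1) :
    ∫⁻ a in Ico (0 : ℝ) 1, ∑ y, ENNReal.ofReal (p (inputAt q s a (V s a)) y) *
      expLogPrimitive θ (arcMass p q y s a) ≤ ENNReal.ofReal K * expLogPrimitive θ s := by
  rcases hs.1.eq_or_lt with rfl | h0
  · have h : expLogPrimitive θ 0 = ⊤ := by simp [expLogPrimitive]
    rw [h, ENNReal.mul_top (by simpa using hK)]
    exact le_top
  have hs' : s ∈ Ioc (0 : ℝ) 1 := ⟨h0, hs.2⟩
  rcases hs.2.eq_or_lt with rfl | h1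
  -- Length one is absorbing: every output that can occur leaves the full circle with mass one,
  -- where the function vanishes.
  · refine le_trans (le_of_eq ?_) zero_le
    rw [setLIntegral_congr_fun (g := fun _ => 0) measurableSet_Ico, lintegral_zero]
    intro a ha
    refine Finset.sum_eq_zero fun y _ => ?_
    have hx := hV.isBestSymbol hq hs' ha
    rcases ((hp (inputAt q 1 a (V 1 a))).1 y).eq_or_lt with h | h
    · simp [← h]
    · rw [arcMass_one hq (outputPMF_pos hp hq hx.1 h).ne']
      simp [expLogPrimitive]
  have hs1 : s ∈ Ioo (0 : ℝ) 1 := ⟨h0, h1⟩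
  have hfin : expLogPrimitive θ s ≠ ⊤ := by
    rw [expLogPrimitive_of_mem hs1]; exact ENNReal.ofReal_ne_top
  calc _ ≤ ∫⁻ a in Ico (0 : ℝ) 1, expLogPrimitive θ s *
        ∑ y, ENNReal.ofReal (p (inputAt q s a (V s a)) y) *
          ENNReal.ofReal (arcMass p q y s a / s) ^ (-θ s) := by
        refine setLIntegral_mono' measurableSet_Ico fun a ha => ?_
        rw [Finset.mul_sum]
        refine Finset.sum_le_sum fun y _ => ?_
        have hx := hV.isBestSymbol hq hs' ha
        rcases ((hp (inputAt q s a (V s a))).1 y).eq_or_lt with h | h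
        · simp [← h]
        · rw [mul_left_comm]
          gcongr
          exact expLogPrimitive_le_mul_rpow hθ hs1 (hx.arcMass_pos hp hq hs' h)
    _ = expLogPrimitive θ s * actualMGF p q V s (θ s) := by
        rw [lintegral_const_mul' _ _ hfin, actualMGF]
    _ ≤ _ := by
        rw [mul_comm]
        gcongr
        exact hmgf s hs1

/-- A monotone exponent that agrees with the given `ρ` for short intervals, or is smaller. -/
lemma exists_monotone_exponent (hp : IsChannel p) (hq : q ∈ stdSimplex ℝ 𝒳)
    (hV : IsMaxInfoGainRule p q V) {ρ K : ℝ} (hρ : 0 ≤ ρ)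
    (hφ : idealMGF p q ρ < K) (hΨ : Psi p q V < ENNReal.ofReal K) :
    ∃ θ : ℝ → ℝ, MonotoneOn θ (Ioo 0 1) ∧ (∀ s ∈ Ioo (0 : ℝ) 1, 0 ≤ θ s) ∧
      (∀ s ∈ Ioo (0 : ℝ) 1, actualMGF p q V s (θ s) ≤ ENNReal.ofReal K) ∧
      ∃ s₀ ∈ Ioo (0 : ℝ) 1, θ s₀ ≤ ρ := by
  have hK : 0 < K := by simpa using (zero_le.trans_lt hΨ)
  simp only [Psi, iInf_lt_iff] at hΨ
  obtain ⟨τ, hτ, hτ0, hlt⟩ := hΨ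
  have hle : ∀ s ∈ Ioo (0 : ℝ) 1, actualMGF p q V s (τ s) ≤ ENNReal.ofReal K := fun s hs =>
    (le_iSup₂ (f := fun s (_ : s ∈ Ioo (0 : ℝ) 1) => actualMGF p q V s (τ s)) s hs).trans hlt.le
  -- If `τ` falls to `ρ` somewhere, it serves unchanged. Otherwise `τ > ρ` throughout, and lowering
  -- it to `ρ` near `0` preserves monotonicity.
  by_cases h : ∃ s₀ ∈ Ioo (0 : ℝ) 1, τ s₀ ≤ ρ
  · exact ⟨τ, hτ, hτ0, hle, h⟩
  push Not at h
  have hev := (tendsto_actualMGF hp hq hV hρ).eventually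
    (gt_mem_nhds ((ENNReal.ofReal_lt_ofReal_iff hK).mpr hφ))
  obtain ⟨s₁, hs₁, hsub⟩ := mem_nhdsGT_iff_exists_Ioo_subset.mp hev
  have hs₁ : 0 < s₁ := hs₁
  refine ⟨fun s => if s < s₁ then ρ else τ s, ?_, ?_, ?_, min (s₁ / 2) (1 / 2), ⟨by positivity, ?_⟩, ?_⟩
  · intro s hs t ht hst
    dsimp only
    split_ifs with h1 h2 h2
    · exact le_rfl
    · exact (h t ht).le
    · exact absurd (hst.trans_lt h2) h1
    · exact hτ hs ht hst
  · intro s hs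
    dsimp only
    split_ifs
    · exact hρ
    · exact hτ0 s hs
  · intro s hs
    dsimp only
    split_ifs with h1
    · exact (hsub ⟨hs.1, h1⟩ : _ < _).le
    · exact hle s hs
  · exact (min_le_right _ _).trans_lt (by norm_num)
  · have : min (s₁ / 2) (1 / 2) < s₁ := (min_le_left _ _).trans_lt (by linarith)
    exact (if_pos this).le

/-- A function of the interval length that the scheme contracts by the factor `K`. -/
lemma exists_contracted_function (hp : IsChannel p) (hq : q ∈ stdSimplex ℝ 𝒳)
    (hV : IsMaxInfoGainRule p q V) {ρ K : ℝ} (hρ : 0 ≤ ρ)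
    (hφ : idealMGF p q ρ < K) (hΨ : Psi p q V < ENNReal.ofReal K) :
    ∃ f : ℝ → ℝ≥0∞, Measurable f ∧ (∀ s ≤ 1 / 2, 1 ≤ f s) ∧
      (∀ s ∈ Icc (0 : ℝ) 1, ∫⁻ a in Ico (0 : ℝ) 1, ∑ y,
        ENNReal.ofReal (p (inputAt q s a (V s a)) y) * f (arcMass p q y s a) ≤
          ENNReal.ofReal K * f s) ∧
      ∃ A, ∃ s₀ > 0, ∀ s ∈ Ioo 0 s₀, f s ≤ ENNReal.ofReal (A * s ^ (-ρ)) := by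
  obtain ⟨θ, hθ, hθ0, hmgf, s₀, hs₀, hle⟩ := exists_monotone_exponent hp hq hV hρ hφ hΨ
  obtain ⟨A, hA⟩ := exists_expLogPrimitive_le hθ hs₀ hle
  have hK : 0 < K := by simpa using (zero_le.trans_lt hΨ)
  exact ⟨expLogPrimitive θ, (expLogPrimitive_antitone hθ hθ0).measurable,
    fun s hs => one_le_expLogPrimitive hθ hθ0 hs,
    fun s hs => lintegral_expLogPrimitive_le hp hq hV hθ hK hmgf hs, A, s₀, hs₀.1, hA⟩

end Lyapunov

/-! ### Recursion over channel uses -/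

section ErrorRecursion

/-- A uniform shift makes the starting point of the arc uniform whatever the left end `t` is, so the
step depends on the past only through the length. -/
lemma lintegral_comp_fract_add (H : ℝ → ℝ≥0∞) (t : ℝ) :
    ∫⁻ v in Ico (0 : ℝ) 1, H (Int.fract (t + v)) = ∫⁻ a in Ico (0 : ℝ) 1, H a := by
  have hper : Function.Periodic (fun z => H (Int.fract z)) 1 := fun z => by simp
  have h1 : ∫⁻ v in Ioc (0 : ℝ) 1, H (Int.fract (t + v)) =
      ∫⁻ z in Ioc t (t + 1), H (Int.fract z) := by
    have h := (measurePreserving_add_left volume t).setLIntegral_comp_preimage_emb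
      (measurableEmbedding_addLeft t) (fun z => H (Int.fract z)) (Ioc t (t + 1))
    rw [← h]
    simp
  have h2 : ∫⁻ z in Ioc t (t + 1), H (Int.fract z) = ∫⁻ z in Ioc (0 : ℝ) (0 + 1), H (Int.fract z) :=
    (isAddFundamentalDomain_Ioc one_pos t).setLIntegral_eq (isAddFundamentalDomain_Ioc one_pos 0) _
      hper.map_vadd_zmultiples
  rw [setLIntegral_congr Ico_ae_eq_Ioc, h1, h2, zero_add, ← setLIntegral_congr Ico_ae_eq_Ioc]
  exact setLIntegral_congr_fun measurableSet_Ico fun z hz => by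
    simp only [Int.fract_eq_self.mpr hz]

lemma leftEnd_castSucc {N : ℕ} (s : Fin (N + 1) → ℝ) (m : Fin N) :
    leftEnd s m.castSucc = leftEnd (fun i => s i.castSucc) m := by
  simp only [leftEnd, Finset.sum_filter, Fin.sum_univ_castSucc, Fin.castSucc_lt_castSucc_iff]
  simp [(Fin.castSucc_lt_last m).not_gt]

lemma leftEnd_last {N : ℕ} (s : Fin (N + 1) → ℝ) :
    leftEnd s (Fin.last N) = ∑ i : Fin N, s i.castSucc := by
  simp [leftEnd, Finset.sum_filter, Fin.sum_univ_castSucc, Fin.castSucc_lt_last]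

variable {𝒳 𝒴 : Type*} [Fintype 𝒳] [LinearOrder 𝒳] [Nonempty 𝒳]
  {p : 𝒳 → 𝒴 → ℝ} {q : 𝒳 → ℝ} {V : ℝ → ℝ → ℝ}

lemma sum_arcMass_leftEnd (hq : q ∈ stdSimplex ℝ 𝒳) (y : 𝒴) (c : ℝ) :
    ∀ {N : ℕ} (s : Fin N → ℝ),
      ∑ m, arcMass p q y (s m) (leftEnd s m + c) = arcMass p q y (∑ m, s m) c
  | 0, s => by simp [arcMass]
  | N + 1, s => by
    rw [Fin.sum_univ_castSucc, Fin.sum_univ_castSucc (f := s), arcMass_add hq, leftEnd_last,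
      ← sum_arcMass_leftEnd hq y c (fun i => s i.castSucc), add_comm c]
    simp_rw [leftEnd_castSucc]

lemma measurable_init (n : ℕ) : Measurable fun u : Fin (n + 1) → ℝ => (Fin.init u : Fin n → ℝ) :=
  measurable_pi_lambda _ fun i => measurable_pi_apply i.castSucc

lemma measurable_len (hq : q ∈ stdSimplex ℝ 𝒳) {N : ℕ} :
    ∀ (n : ℕ) (y : Fin n → 𝒴) (m : Fin N), Measurable fun u => len p q N n y u m
  | 0, _, _ => measurable_const
  | n + 1, y, m => by
    have ih := fun m' : Fin N => (measurable_len hq n (Fin.init y) m').comp (measurable_init n)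
    have h1 : Measurable fun u : Fin (n + 1) → ℝ =>
        leftEnd (len p q N n (Fin.init y) (Fin.init u)) m + u (Fin.last n) :=
      (Finset.measurable_sum _ fun m' _ => ih m').add (measurable_pi_apply _)
    exact (continuous_arcMass hq p (y (Fin.last n))).measurable.comp ((ih m).prodMk h1)

variable [Fintype 𝒴]

lemma len_nonneg (hp : IsChannel p) (hq : q ∈ stdSimplex ℝ 𝒳) {N : ℕ} :
    ∀ (n : ℕ) (y : Fin n → 𝒴) (u : Fin n → ℝ) (m : Fin N), 0 ≤ len p q N n y u m
  | 0, _, _, _ => inv_nonneg.mpr (Nat.cast_nonneg N)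
  | n + 1, y, u, m => arcMass_nonneg hp hq _ (len_nonneg hp hq n (Fin.init y) (Fin.init u) m) _

/-- Adjacent arcs join into one arc. Equality can fail: an output with `p(y) = 0` gives density `0`
by division by zero, and `N = 0` is allowed. -/
lemma sum_len_le_one (hp : IsChannel p) (hq : q ∈ stdSimplex ℝ 𝒳) {N : ℕ} :
    ∀ (n : ℕ) (y : Fin n → 𝒴) (u : Fin n → ℝ), ∑ m, len p q N n y u m ≤ 1
  | 0, _, _ => by
    simp only [len, Finset.sum_const, Finset.card_univ, Fintype.card_fin, nsmul_eq_mul]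
    exact mul_inv_le_one
  | n + 1, y, u => by
    simp only [len]
    rw [sum_arcMass_leftEnd hq]
    exact arcMass_le_one hp hq _ (sum_len_le_one hp hq n _ _) _

lemma len_le_one (hp : IsChannel p) (hq : q ∈ stdSimplex ℝ 𝒳) {N : ℕ} (n : ℕ) (y : Fin n → 𝒴)
    (u : Fin n → ℝ) (m : Fin N) : len p q N n y u m ≤ 1 :=
  (Finset.single_le_sum (fun m _ => len_nonneg hp hq n y u m) (Finset.mem_univ m)).trans
    (sum_len_le_one hp hq n y u)

/-- Two intervals of total length at most one cannot both exceed one half. -/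
lemma len_le_half (hp : IsChannel p) (hq : q ∈ stdSimplex ℝ 𝒳) {N : ℕ} {n : ℕ} {y : Fin n → 𝒴}
    {u : Fin n → ℝ} {m : Fin N}
    (h : ∃ m', m' ≠ m ∧ len p q N n y u m ≤ len p q N n y u m') : len p q N n y u m ≤ 1 / 2 := by
  obtain ⟨m', hne, hle⟩ := h
  have h1 : ∑ i ∈ {m', m}, len p q N n y u i ≤ ∑ i, len p q N n y u i :=
    Finset.sum_le_sum_of_subset_of_nonneg (Finset.subset_univ _)
      fun i _ _ => len_nonneg hp hq n y u i
  rw [Finset.sum_pair hne] at h1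
  linarith [sum_len_le_one (N := N) hp hq n y u]

lemma outputProb_nonneg (hp : IsChannel p) {N : ℕ} (m : Fin N) :
    ∀ (n : ℕ) (y : Fin n → 𝒴) (u : Fin n → ℝ), 0 ≤ outputProb p q V m n y u
  | 0, _, _ => zero_le_one
  | n + 1, y, u => mul_nonneg (outputProb_nonneg hp m n (Fin.init y) (Fin.init u)) ((hp _).1 _)

lemma IsMaxInfoGainRule.measurable_outputProb (hq : q ∈ stdSimplex ℝ 𝒳)
    (hV : IsMaxInfoGainRule p q V) {N : ℕ} (m : Fin N) (n : ℕ) (y : Fin n → 𝒴) :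
    Measurable fun u => outputProb p q V m n y u := by
  induction n with
  | zero => exact measurable_const
  | succ n ih =>
    have hl := fun m' : Fin N =>
      (measurable_len (p := p) hq n (Fin.init y) m').comp (measurable_init n)
    have h1 : Measurable fun u : Fin (n + 1) → ℝ =>
        Int.fract (leftEnd (len p q N n (Fin.init y) (Fin.init u)) m + u (Fin.last n)) :=
      measurable_fract.comp ((Finset.measurable_sum _ fun m' _ => hl m').add (measurable_pi_apply _))
    have h2 := (hV.measurable_comp_inputAt fun x => p x (y (Fin.last n))).comp ((hl m).prodMk h1)
    simp only [outputProb, encode]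
    exact ((ih (Fin.init y)).comp (measurable_init n)).mul h2

/-- Law of `n` cyclic shifts. -/
def shiftMeasure (n : ℕ) : Measure (Fin n → ℝ) :=
  Measure.pi fun _ : Fin n => (volume : Measure ℝ).restrict (Ico 0 1)

lemma lintegral_shiftMeasure_succ {n : ℕ} {F : (Fin (n + 1) → ℝ) → ℝ≥0∞} (hF : Measurable F) :
    ∫⁻ u, F u ∂(shiftMeasure (n + 1)) =
      ∫⁻ u, (∫⁻ v in Ico (0 : ℝ) 1, F (Fin.snoc u v)) ∂(shiftMeasure n) := by
  have h := (measurePreserving_piFinSuccAbove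
    (fun _ : Fin (n + 1) => (volume : Measure ℝ).restrict (Ico 0 1)) (Fin.last n)).symm
  rw [shiftMeasure, ← h.lintegral_comp hF, lintegral_prod_symm]
  · refine lintegral_congr fun u => lintegral_congr fun v => ?_
    simp [MeasurableEquiv.piFinSuccAbove, Fin.insertNthEquiv]
  · exact (hF.comp (MeasurableEquiv.measurable _)).aemeasurable

lemma sum_snoc {n : ℕ} (F : (Fin (n + 1) → 𝒴) → ℝ≥0∞) :
    ∑ y, F y = ∑ y : Fin n → 𝒴, ∑ b, F (Fin.snoc y b) := by
  rw [← (Fin.snocEquiv fun _ => 𝒴).sum_comp, Fintype.sum_prod_type_right]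
  rfl

/-- Expectation of `f (S_n)` given the message `m`. -/
def expLen (p : 𝒳 → 𝒴 → ℝ) (q : 𝒳 → ℝ) (V : ℝ → ℝ → ℝ) {N : ℕ} (m : Fin N) (f : ℝ → ℝ≥0∞)
    (n : ℕ) : ℝ≥0∞ :=
  ∫⁻ u, ∑ y : Fin n → 𝒴, ENNReal.ofReal (outputProb p q V m n y u) * f (len p q N n y u m)
    ∂(shiftMeasure n)

lemma expLen_le (hp : IsChannel p) (hq : q ∈ stdSimplex ℝ 𝒳) (hV : IsMaxInfoGainRule p q V)
    {f : ℝ → ℝ≥0∞} (hf : Measurable f) {K : ℝ≥0∞} (hK : K ≠ ⊤)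
    (hstep : ∀ s ∈ Icc (0 : ℝ) 1, ∫⁻ a in Ico (0 : ℝ) 1, ∑ y,
      ENNReal.ofReal (p (inputAt q s a (V s a)) y) * f (arcMass p q y s a) ≤ K * f s)
    {N : ℕ} (m : Fin N) (n : ℕ) : expLen p q V m f n ≤ K ^ n * f (N : ℝ)⁻¹ := by
  induction n with
  | zero =>
    simp [expLen, outputProb, len, shiftMeasure]
  | succ n ih =>
    have hmeas : ∀ n, Measurable fun u => ∑ y : Fin n → 𝒴,
        ENNReal.ofReal (outputProb p q V m n y u) * f (len p q N n y u m) := fun n =>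
      Finset.measurable_sum _ fun y _ => (ENNReal.measurable_ofReal.comp
        (hV.measurable_outputProb hq m n y)).mul (hf.comp (measurable_len hq n y m))
    have hinner : ∀ u : Fin n → ℝ, ∫⁻ v in Ico (0 : ℝ) 1, ∑ y : Fin (n + 1) → 𝒴,
        ENNReal.ofReal (outputProb p q V m (n + 1) y (Fin.snoc u v)) *
          f (len p q N (n + 1) y (Fin.snoc u v) m) ≤
        K * ∑ y : Fin n → 𝒴, ENNReal.ofReal (outputProb p q V m n y u) * f (len p q N n y u m) := by
      intro u
      -- `G y a` is the expectation over the last output when the arc starts at `a`; averaging it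
      -- over `a` is exactly `hstep`.
      let G : (Fin n → 𝒴) → ℝ → ℝ≥0∞ := fun y a => ∑ b,
        ENNReal.ofReal (p (inputAt q (len p q N n y u m) a (V (len p q N n y u m) a)) b) *
          f (arcMass p q b (len p q N n y u m) a)
      have hG : ∀ y, Measurable (G y) := fun y => Finset.measurable_sum _ fun b _ =>
        ((hV.measurable_comp_inputAt fun x => ENNReal.ofReal (p x b)).comp
          (measurable_const (a := len p q N n y u m) |>.prodMk measurable_id)).mul
        (hf.comp ((continuous_arcMass hq p b).measurable.comp
          (measurable_const (a := len p q N n y u m) |>.prodMk measurable_id)))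
      calc _ = ∫⁻ v in Ico (0 : ℝ) 1, ∑ y : Fin n → 𝒴, ENNReal.ofReal (outputProb p q V m n y u) *
            G y (Int.fract (leftEnd (len p q N n y u) m + v)) := by
            refine lintegral_congr fun v => ?_
            rw [sum_snoc]
            refine Finset.sum_congr rfl fun y _ => ?_
            rw [Finset.mul_sum]
            refine Finset.sum_congr rfl fun b _ => ?_
            simp only [outputProb, len, Fin.init_snoc, Fin.snoc_last, encode, arcMass_fract hq]
            rw [ENNReal.ofReal_mul (outputProb_nonneg hp m n y u), mul_assoc]
        _ = ∑ y : Fin n → 𝒴, ENNReal.ofReal (outputProb p q V m n y u) *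
            ∫⁻ a in Ico (0 : ℝ) 1, G y a := by
            rw [lintegral_finsetSum]
            · refine Finset.sum_congr rfl fun y _ => ?_
              rw [lintegral_const_mul' _ _ ENNReal.ofReal_ne_top, lintegral_comp_fract_add]
            · exact fun y _ => ((hG y).comp (measurable_fract.comp
                (measurable_const.add measurable_id))).const_mul _
        _ ≤ _ := by
            rw [Finset.mul_sum]
            refine Finset.sum_le_sum fun y _ => ?_
            rw [mul_left_comm]
            gcongr
            exact hstep _ ⟨len_nonneg hp hq n y u m, len_le_one hp hq n y u m⟩
    rw [expLen, lintegral_shiftMeasure_succ (hmeas (n + 1))]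
    calc _ ≤ ∫⁻ u, K * ∑ y : Fin n → 𝒴, ENNReal.ofReal (outputProb p q V m n y u) *
          f (len p q N n y u m) ∂(shiftMeasure n) := lintegral_mono hinner
      _ = K * expLen p q V m f n := by rw [lintegral_const_mul' _ _ hK, expLen]
      _ ≤ K * (K ^ n * f (N : ℝ)⁻¹) := by gcongr
      _ = K ^ (n + 1) * f (N : ℝ)⁻¹ := by rw [pow_succ', mul_assoc]

/-- The error probability is bounded by the expectation of any function of the interval length that
is at least one up to length one half. -/
lemma errorProb_le (hp : IsChannel p) (hq : q ∈ stdSimplex ℝ 𝒳) (hV : IsMaxInfoGainRule p q V)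
    {f : ℝ → ℝ≥0∞} (hf : Measurable f) (hf1 : ∀ s ≤ 1 / 2, 1 ≤ f s) {K : ℝ≥0∞} (hK : K ≠ ⊤)
    (hstep : ∀ s ∈ Icc (0 : ℝ) 1, ∫⁻ a in Ico (0 : ℝ) 1, ∑ y,
      ENNReal.ofReal (p (inputAt q s a (V s a)) y) * f (arcMass p q y s a) ≤ K * f s)
    {N : ℕ} (hN : N ≠ 0) (n : ℕ) : errorProb p q V N n ≤ K ^ n * f (N : ℝ)⁻¹ := by
  classical
  have h : ∀ m : Fin N, ∫⁻ u, ∑ y : Fin n → 𝒴,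
      (if ∃ m', m' ≠ m ∧ len p q N n y u m ≤ len p q N n y u m'
        then ENNReal.ofReal (outputProb p q V m n y u) else 0) ∂(shiftMeasure n) ≤
      K ^ n * f (N : ℝ)⁻¹ := by
    intro m
    refine le_trans (lintegral_mono fun u => Finset.sum_le_sum fun y _ => ?_)
      (expLen_le hp hq hV hf hK hstep m n)
    split_ifs with h
    · exact le_mul_of_one_le_right' (hf1 _ (len_le_half hp hq h))
    · exact zero_le
  calc errorProb p q V N n ≤ (N : ℝ≥0∞)⁻¹ * ∑ _m : Fin N, K ^ n * f (N : ℝ)⁻¹ := by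
        unfold errorProb
        exact mul_le_mul_right (Finset.sum_le_sum fun m _ => h m) _
    _ = K ^ n * f (N : ℝ)⁻¹ := by
        rw [Finset.sum_const, Finset.card_univ, Fintype.card_fin, nsmul_eq_mul, ← mul_assoc,
          ENNReal.inv_mul_cancel (by simpa using hN) (by simp), one_mul]

lemma errorProb_one (p : 𝒳 → 𝒴 → ℝ) (q : 𝒳 → ℝ) (V : ℝ → ℝ → ℝ) (n : ℕ) :
    errorProb p q V 1 n = 0 := by
  have h : ∀ m m' : Fin 1, ¬ m' ≠ m := fun m m' => not_not.mpr (Subsingleton.elim _ _)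
  simp [errorProb, h]

end ErrorRecursion

/-! ### Size of the message set -/

section NumMessages

lemma numMessages_of_nonpos {R : ℝ} (hR : R ≤ 0) (n : ℕ) : numMessages n R = 1 := by
  have h : Real.exp (n * R) ≤ 1 :=
    Real.exp_le_one_iff.mpr (mul_nonpos_of_nonneg_of_nonpos (Nat.cast_nonneg n) hR)
  rw [numMessages, Nat.ceil_eq_iff one_ne_zero]
  exact ⟨by simpa using Real.exp_pos _, by simpa using h⟩

lemma numMessages_ne_zero (n : ℕ) (R : ℝ) : numMessages n R ≠ 0 :=
  (Nat.ceil_pos.mpr (Real.exp_pos _)).ne'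

lemma numMessages_le {R : ℝ} (hR : 0 ≤ R) (n : ℕ) :
    (numMessages n R : ℝ) ≤ 2 * Real.exp (n * R) := by
  have h1 := (Nat.ceil_lt_add_one (Real.exp_pos (n * R)).le).le
  have h2 : 1 ≤ Real.exp (n * R) := Real.one_le_exp (by positivity)
  rw [numMessages]
  linarith

lemma tendsto_numMessages_inv {R : ℝ} (hR : 0 < R) :
    Tendsto (fun n : ℕ => (numMessages n R : ℝ)⁻¹) atTop (𝓝 0) := by
  refine tendsto_inv_atTop_zero.comp (tendsto_atTop_mono (fun n => Nat.le_ceil _) ?_)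
  exact Real.tendsto_exp_atTop.comp (tendsto_natCast_atTop_atTop.atTop_mul_const hR)

end NumMessages

/-! ### The ideal moment generating function near zero -/

section IdealMGF

lemma eventually_lt_of_hasDerivAt_neg {f : ℝ → ℝ} {f' x : ℝ} (hf : HasDerivAt f f' x) (hf' : f' < 0) :
    ∀ᶠ z in 𝓝[>] x, f z < f x := by
  have h := (hasDerivAt_iff_tendsto_slope.mp hf).mono_left
    (nhdsWithin_mono x fun z (hz : x < z) => hz.ne')
  filter_upwards [h.eventually (gt_mem_nhds hf'), self_mem_nhdsWithin] with z hz hxz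
  have hxz : 0 < z - x := sub_pos.mpr hxz
  rw [slope_def_field, div_neg_iff] at hz
  rcases hz with hz | hz <;> linarith [hz.1, hz.2]

variable {𝒳 𝒴 : Type*} [Fintype 𝒳] [Fintype 𝒴] {p : 𝒳 → 𝒴 → ℝ} {q : 𝒳 → ℝ}

lemma idealMGF_pos (hp : IsChannel p) (hq : q ∈ stdSimplex ℝ 𝒳) (ρ : ℝ) : 0 < idealMGF p q ρ := by
  obtain ⟨x, _, hx⟩ := Finset.exists_lt_of_sum_lt (s := Finset.univ) (f := fun _ => (0 : ℝ))
    (g := q) (by simp [hq.2])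
  obtain ⟨y, _, hy⟩ := Finset.exists_lt_of_sum_lt (s := Finset.univ) (f := fun _ => (0 : ℝ))
    (g := p x) (by simp [(hp x).2])
  have hnn : ∀ x y, 0 ≤ p x y * (p x y / outputPMF p q y) ^ (-ρ) := fun x y =>
    mul_nonneg ((hp x).1 y) (Real.rpow_nonneg (likRatio_nonneg hp hq x y) _)
  refine Finset.sum_pos' (fun x _ => mul_nonneg (hq.1 x) (Finset.sum_nonneg fun y _ => hnn x y))
    ⟨x, Finset.mem_univ x, mul_pos hx (Finset.sum_pos' (fun y _ => hnn x y)
      ⟨y, Finset.mem_univ y, mul_pos hy (Real.rpow_pos_of_pos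
        (div_pos hy (outputPMF_pos hp hq hx hy)) _)⟩)⟩

lemma hasDerivAt_idealMGF (hp : IsChannel p) (hq : q ∈ stdSimplex ℝ 𝒳) :
    HasDerivAt (idealMGF p q) (-mutualInfo p q) 0 := by
  have h1 : idealMGF p q = fun ρ => ∑ x, ∑ y, q x * p x y * likRatio p q x y ^ (-ρ) := by
    funext ρ
    simp only [idealMGF, Finset.mul_sum, mul_assoc]
    rfl
  have h2 : -mutualInfo p q = ∑ x, ∑ y, q x * p x y * -Real.log (likRatio p q x y) := by
    simp only [mutualInfo, mul_neg, Finset.sum_neg_distrib]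
    rfl
  rw [h1, h2]
  refine HasDerivAt.fun_sum fun x _ => HasDerivAt.fun_sum fun y _ => ?_
  rcases (mul_nonneg (hq.1 x) ((hp x).1 y)).eq_or_lt with h | h
  · simp only [← h, zero_mul]
    exact hasDerivAt_const _ _
  · have hx : 0 < q x := lt_of_le_of_ne (hq.1 x) fun h0 => by simp [← h0] at h
    have hy : 0 < p x y := lt_of_le_of_ne ((hp x).1 y) fun h0 => by simp [← h0] at h
    have hl : 0 < likRatio p q x y := div_pos hy (outputPMF_pos hp hq hx hy)
    have h3 := ((hasDerivAt_neg (0 : ℝ)).const_rpow hl).const_mul (q x * p x y)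
    simpa using h3

lemma idealMGF_zero (hp : IsChannel p) (hq : q ∈ stdSimplex ℝ 𝒳) : idealMGF p q 0 = 1 := by
  simp [idealMGF, (hp _).2, hq.2]

end IdealMGF

/-! ### Exponential decay and the error exponent -/

section Exponent

variable {𝒳 𝒴 : Type*} [Fintype 𝒳] [LinearOrder 𝒳] [Nonempty 𝒳] [Fintype 𝒴]
  {p : 𝒳 → 𝒴 → ℝ} {q : 𝒳 → ℝ} {V : ℝ → ℝ → ℝ}

/-- Exponential decay of the error probability. -/
lemma eventually_errorProb_le (hp : IsChannel p) (hq : q ∈ stdSimplex ℝ 𝒳)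
    (hV : IsMaxInfoGainRule p q V) {R ρ c : ℝ} (hR : 0 < R) (hρ : 0 ≤ ρ)
    (hφ : idealMGF p q ρ < Real.exp (-ρ * R - c))
    (hΨ : Psi p q V < ENNReal.ofReal (Real.exp (-ρ * R - c))) :
    ∀ᶠ n : ℕ in atTop, errorProb p q V (numMessages n R) n ≤
      ENNReal.ofReal (Real.exp (-c) ^ n) := by
  have hΨ' : (Psi p q V).toReal < Real.exp (-ρ * R - c) := by
    rw [ENNReal.lt_ofReal_iff_toReal_lt (ne_top_of_lt hΨ)] at hΨ
    exact hΨ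
  -- The room left above `K` makes `b < e^{-c}` below, and the factor `(b / e^{-c})^n` absorbs the
  -- constant `|A| 2^ρ`.
  obtain ⟨K, hK1, hK2⟩ := exists_between (max_lt hφ hΨ')
  rw [max_lt_iff] at hK1
  have hK0 : 0 < K := ENNReal.toReal_nonneg.trans_lt hK1.2
  obtain ⟨f, hf, hf1, hstep, A, s₀, hs₀, hA⟩ := exists_contracted_function hp hq hV hρ hK1.1
    ((ENNReal.lt_ofReal_iff_toReal_lt (ne_top_of_lt hΨ)).mpr hK1.2)
  set b := K * Real.exp (R * ρ) with hb
  have hb0 : 0 < b := by positivity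
  have hbc : b < Real.exp (-c) := by
    calc b < Real.exp (-ρ * R - c) * Real.exp (R * ρ) :=
          mul_lt_mul_of_pos_right hK2 (Real.exp_pos _)
      _ = Real.exp (-c) := by rw [← Real.exp_add]; ring_nf
  have hlim : Tendsto (fun n : ℕ => |A| * 2 ^ ρ * (b / Real.exp (-c)) ^ n) atTop (𝓝 0) := by
    rw [← mul_zero (|A| * 2 ^ ρ)]
    exact (tendsto_pow_atTop_nhds_zero_of_lt_one (by positivity)
      ((div_lt_one (Real.exp_pos _)).mpr hbc)).const_mul _
  filter_upwards [(tendsto_numMessages_inv hR).eventually (gt_mem_nhds hs₀),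
    hlim.eventually (gt_mem_nhds one_pos)] with n hn1 hn2
  have hN : 0 < (numMessages n R : ℝ) := by
    exact_mod_cast Nat.pos_of_ne_zero (numMessages_ne_zero n R)
  refine (errorProb_le hp hq hV hf hf1 ENNReal.ofReal_ne_top hstep
    (numMessages_ne_zero n R) n).trans ?_
  refine (mul_le_mul_right (hA _ ⟨inv_pos.mpr hN, hn1⟩) _).trans ?_
  rw [← ENNReal.ofReal_pow hK0.le, ← ENNReal.ofReal_mul (by positivity)]
  refine ENNReal.ofReal_le_ofReal ?_
  have h1 : ((numMessages n R : ℝ)⁻¹) ^ (-ρ) ≤ 2 ^ ρ * Real.exp (R * ρ) ^ n := by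
    rw [Real.inv_rpow hN.le, Real.rpow_neg hN.le, inv_inv]
    calc (numMessages n R : ℝ) ^ ρ ≤ (2 * Real.exp (n * R)) ^ ρ :=
          Real.rpow_le_rpow hN.le (numMessages_le hR.le n) hρ
      _ = 2 ^ ρ * Real.exp (R * ρ) ^ n := by
          rw [Real.mul_rpow (by norm_num) (Real.exp_pos _).le, ← Real.exp_mul, ← Real.exp_nat_mul,
            mul_assoc]
  calc K ^ n * (A * ((numMessages n R : ℝ)⁻¹) ^ (-ρ))
      ≤ K ^ n * (|A| * (2 ^ ρ * Real.exp (R * ρ) ^ n)) := by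
        refine mul_le_mul_of_nonneg_left ?_ (by positivity)
        exact mul_le_mul (le_abs_self A) h1 (by positivity) (abs_nonneg A)
    _ = |A| * 2 ^ ρ * (b / Real.exp (-c)) ^ n * Real.exp (-c) ^ n := by
        rw [hb, div_pow, mul_pow]
        field_simp
    _ ≤ 1 * Real.exp (-c) ^ n := mul_le_mul_of_nonneg_right hn2.le (by positivity)
    _ = Real.exp (-c) ^ n := one_mul _

lemma le_errorExponent {R c : ℝ} (h : ∀ᶠ n : ℕ in atTop, errorProb p q V (numMessages n R) n ≤
    ENNReal.ofReal (Real.exp (-c) ^ n)) : (c : EReal) ≤ errorExponent p q V R := by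
  refine le_limsup_of_frequently_le (Eventually.frequently ?_) (by isBoundedDefault)
  filter_upwards [h, eventually_gt_atTop 0] with n hn hn0
  have h1 : ENNReal.log (errorProb p q V (numMessages n R) n) ≤ ((-(n * c) : ℝ) : EReal) := by
    refine (ENNReal.log_le_log hn).trans (le_of_eq ?_)
    rw [ENNReal.log_ofReal_of_pos (by positivity), ← Real.exp_nat_mul, Real.log_exp]
    ring_nf
  have h2 : ((n * c : ℝ) : EReal) ≤ -ENNReal.log (errorProb p q V (numMessages n R) n) := by
    rw [EReal.le_neg]
    exact_mod_cast h1
  have hn' : (0 : ℝ) < n := by exact_mod_cast hn0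
  calc (c : EReal) = (((n : ℝ)⁻¹ : ℝ) : EReal) * ((n * c : ℝ) : EReal) := by
        rw [← EReal.coe_mul, inv_mul_cancel_left₀ hn'.ne']
    _ ≤ _ := mul_le_mul_of_nonneg_left h2 (by exact_mod_cast (inv_pos.mpr hn').le)

lemma errorExponent_of_nonpos {R : ℝ} (hR : R ≤ 0) : errorExponent p q V R = ⊤ := by
  rw [EReal.eq_top_iff_forall_lt]
  intro c
  have h : ((c + 1 : ℝ) : EReal) ≤ errorExponent p q V R := le_errorExponent
    (Eventually.of_forall fun n => by simp [numMessages_of_nonpos hR, errorProb_one])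
  exact lt_of_lt_of_le (by exact_mod_cast lt_add_one c) h

/-- Lower bound for the error exponent in terms of the moment generating functions. -/
lemma sub_log_max_le_errorExponent (hp : IsChannel p) (hq : q ∈ stdSimplex ℝ 𝒳)
    (hV : IsMaxInfoGainRule p q V) (hΨ : Psi p q V ≠ ⊤) (R : ℝ) {ρ : ℝ} (hρ : 0 ≤ ρ) :
    ((-ρ * R : ℝ) : EReal) - ENNReal.log (max (ENNReal.ofReal (idealMGF p q ρ)) (Psi p q V)) ≤
      errorExponent p q V R := by
  rcases le_or_gt R 0 with hR | hR
  · rw [errorExponent_of_nonpos hR]; exact le_top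
  set k := max (idealMGF p q ρ) (Psi p q V).toReal with hk
  have hk0 : 0 < k := (idealMGF_pos hp hq ρ).trans_le (le_max_left _ _)
  have hmax : max (ENNReal.ofReal (idealMGF p q ρ)) (Psi p q V) = ENNReal.ofReal k := by
    rw [hk, ENNReal.ofReal_max, ENNReal.ofReal_toReal hΨ]
  rw [hmax, ENNReal.log_ofReal_of_pos hk0, ← EReal.coe_sub, ← EReal.ge_of_forall_gt_iff_ge]
  intro c hc
  have hc' : c < -ρ * R - Real.log k := by exact_mod_cast hc
  have hkc : k < Real.exp (-ρ * R - c) := by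
    rw [← Real.log_lt_iff_lt_exp hk0]; linarith
  refine le_errorExponent (eventually_errorProb_le hp hq hV hR hρ
    ((le_max_left _ _).trans_lt hkc) ?_)
  rw [ENNReal.lt_ofReal_iff_toReal_lt hΨ]
  exact (le_max_right _ _).trans_lt hkc

/-- The error probability vanishes at all rates below the mutual information. -/
lemma tendsto_errorProb (hp : IsChannel p) (hq : q ∈ stdSimplex ℝ 𝒳)
    (hV : IsMaxInfoGainRule p q V) (hΨ : Psi p q V < 1) {R : ℝ} (hRI : R < mutualInfo p q) :
    Tendsto (fun n : ℕ => errorProb p q V (numMessages n R) n) atTop (𝓝 0) := by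
  rcases le_or_gt R 0 with hR | hR
  · simp only [numMessages_of_nonpos hR, errorProb_one]
    exact tendsto_const_nhds
  -- At `ρ = 0` the function `φ(ρ) e^{ρR'}` equals `1` and has slope `R' - I < 0`; the gap `R' - R`
  -- then leaves the decay rate `ρ(R' - R)`.
  obtain ⟨R', hRR', hR'I⟩ := exists_between hRI
  have hd : HasDerivAt (fun ρ => idealMGF p q ρ * Real.exp (ρ * R')) (-mutualInfo p q + R') 0 := by
    have h := (hasDerivAt_idealMGF hp hq).fun_mul ((hasDerivAt_id (0 : ℝ)).mul_const R').exp
    simpa [idealMGF_zero hp hq] using h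
  have hev1 := eventually_lt_of_hasDerivAt_neg hd (by linarith)
  have hev2 : ∀ᶠ ρ in 𝓝[>] (0 : ℝ), Psi p q V < ENNReal.ofReal (Real.exp (-ρ * R')) := by
    have h : Tendsto (fun ρ : ℝ => ENNReal.ofReal (Real.exp (-ρ * R'))) (𝓝 0) (𝓝 1) := by
      have hc : Continuous fun ρ : ℝ => ENNReal.ofReal (Real.exp (-ρ * R')) :=
        ENNReal.continuous_ofReal.comp (by fun_prop)
      simpa using hc.tendsto 0
    exact (h.mono_left nhdsWithin_le_nhds).eventually (lt_mem_nhds hΨ)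
  obtain ⟨ρ, ⟨h1, h2⟩, hρ⟩ := ((hev1.and hev2).and self_mem_nhdsWithin).exists
  have hρ : 0 < ρ := hρ
  have h1' : idealMGF p q ρ < Real.exp (-ρ * R') := by
    rw [zero_mul, Real.exp_zero, mul_one, idealMGF_zero hp hq] at h1
    rw [neg_mul, Real.exp_neg, ← one_div, lt_div_iff₀ (Real.exp_pos _)]
    exact h1
  have hc : 0 < ρ * (R' - R) := mul_pos hρ (by linarith)
  have heq : -ρ * R' = -ρ * R - ρ * (R' - R) := by ring
  rw [heq] at h1' h2
  have hlim : Tendsto (fun n : ℕ => ENNReal.ofReal (Real.exp (-(ρ * (R' - R))) ^ n)) atTop (𝓝 0) := by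
    rw [← ENNReal.ofReal_zero]
    refine ENNReal.tendsto_ofReal (tendsto_pow_atTop_nhds_zero_of_lt_one (Real.exp_pos _).le ?_)
    rw [Real.exp_lt_one_iff]
    linarith
  exact tendsto_of_tendsto_of_tendsto_of_le_of_le' tendsto_const_nhds hlim
    (Eventually.of_forall fun n => zero_le) (eventually_errorProb_le hp hq hV hR hρ.le h1' h2)

end Exponent

/-! ### Attainment of the capacity -/

section Capacity

variable {𝒳 𝒴 : Type*} [Fintype 𝒳] [Fintype 𝒴] {p : 𝒳 → 𝒴 → ℝ} {q : 𝒳 → ℝ}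

/-- The right side is continuous in `q` even where `p(y)` vanishes, which the quotient form does not
show; compactness of the simplex then yields a maximizer. -/
lemma mutualInfo_eq (hp : IsChannel p) (hq : q ∈ stdSimplex ℝ 𝒳) :
    mutualInfo p q = (∑ x, ∑ y, q x * p x y * Real.log (p x y)) +
      ∑ y, Real.negMulLog (outputPMF p q y) := by
  have h1 : ∑ y, Real.negMulLog (outputPMF p q y) =
      ∑ x, ∑ y, -(q x * p x y * Real.log (outputPMF p q y)) := by
    rw [Finset.sum_comm]
    refine Finset.sum_congr rfl fun y _ => ?_
    rw [Finset.sum_neg_distrib, ← Finset.sum_mul, Real.negMulLog, neg_mul]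
    rfl
  rw [h1, ← Finset.sum_add_distrib]
  refine Finset.sum_congr rfl fun x _ => ?_
  rw [← Finset.sum_add_distrib]
  refine Finset.sum_congr rfl fun y _ => ?_
  rcases (mul_nonneg (hq.1 x) ((hp x).1 y)).eq_or_lt with h | h
  · simp [← h]
  · have hx : 0 < q x := lt_of_le_of_ne (hq.1 x) fun h0 => by simp [← h0] at h
    have hy : 0 < p x y := lt_of_le_of_ne ((hp x).1 y) fun h0 => by simp [← h0] at h
    rw [Real.log_div hy.ne' (outputPMF_pos hp hq hx hy).ne']
    ring

lemma exists_mutualInfo_eq_capacity [Nonempty 𝒳] (hp : IsChannel p) :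
    ∃ q ∈ stdSimplex ℝ 𝒳, mutualInfo p q = capacity p := by
  classical
  have hcont : ContinuousOn (mutualInfo p) (stdSimplex ℝ 𝒳) := by
    have h : Continuous fun q : 𝒳 → ℝ => (∑ x, ∑ y, q x * p x y * Real.log (p x y)) +
        ∑ y, Real.negMulLog (outputPMF p q y) := by
      have h2 := Real.continuous_negMulLog
      unfold outputPMF
      fun_prop
    exact h.continuousOn.congr fun q hq => mutualInfo_eq hp hq
  have hne : (stdSimplex ℝ 𝒳).Nonempty :=
    ⟨_, single_mem_stdSimplex ℝ (Classical.arbitrary 𝒳)⟩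
  obtain ⟨q, hq, hmax⟩ := (isCompact_stdSimplex ℝ 𝒳).exists_isMaxOn hne hcont
  have : Nonempty (stdSimplex ℝ 𝒳) := hne.to_subtype
  refine ⟨q, hq, le_antisymm (le_ciSup (f := fun q : stdSimplex ℝ 𝒳 => mutualInfo p q)
    ⟨mutualInfo p q, ?_⟩ ⟨q, hq⟩) (ciSup_le fun q' => hmax q'.2)⟩
  rintro _ ⟨q', rfl⟩
  exact hmax q'.2

lemma mutualInfo_of_eq_one (hq : q ∈ stdSimplex ℝ 𝒳) {x : 𝒳} (hx : q x = 1) :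
    mutualInfo p q = 0 := by
  classical
  have h0 : ∀ x', x' ≠ x → q x' = 0 := by
    intro x' hne
    have h1 : ∑ i ∈ {x', x}, q i ≤ ∑ i, q i :=
      Finset.sum_le_sum_of_subset_of_nonneg (Finset.subset_univ _) fun i _ _ => hq.1 i
    rw [Finset.sum_pair hne, hq.2] at h1
    linarith [hq.1 x']
  have hout : ∀ y, outputPMF p q y = p x y := by
    intro y
    rw [outputPMF, Finset.sum_eq_single x (fun x' _ hne => by simp [h0 x' hne]) (by simp), hx,
      one_mul]
  rw [mutualInfo, Finset.sum_eq_single x (fun x' _ hne => by simp [h0 x' hne]) (by simp)]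
  refine Finset.sum_eq_zero fun y _ => ?_
  rw [hout]
  by_cases hy : p x y = 0
  · simp [hy]
  · simp [div_self hy]

end Capacity

end FeedbackScheme

end

theorem theorem1 {𝒳 𝒴 : Type*} [Fintype 𝒳] [LinearOrder 𝒳] [Nonempty 𝒳] [Fintype 𝒴]
    (p : 𝒳 → 𝒴 → ℝ) (hp : FeedbackScheme.IsChannel p)
    (hred : FeedbackScheme.NoRedundantInputs p) :
    (∀ q ∈ stdSimplex ℝ 𝒳, (∀ x, q x ≠ 1) →
      (∃ V, FeedbackScheme.IsMaxInfoGainRule p q V) ∧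
      ∀ V, FeedbackScheme.IsMaxInfoGainRule p q V →
        FeedbackScheme.Psi p q V < 1 ∧
        ∀ R : ℝ, R < FeedbackScheme.mutualInfo p q →
          Tendsto (fun n : ℕ =>
            FeedbackScheme.errorProb p q V (FeedbackScheme.numMessages n R) n) atTop (𝓝 0) ∧
          (⨆ ρ ∈ Ioi (0 : ℝ), (((-ρ * R : ℝ) : EReal) -
              ENNReal.log (max (ENNReal.ofReal (FeedbackScheme.idealMGF p q ρ))
                (FeedbackScheme.Psi p q V))))
            ≤ FeedbackScheme.errorExponent p q V R) ∧
    (∃ q ∈ stdSimplex ℝ 𝒳, FeedbackScheme.mutualInfo p q = FeedbackScheme.capacity p ∧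
      (∃ V, FeedbackScheme.IsMaxInfoGainRule p q V) ∧
      ∀ V, FeedbackScheme.IsMaxInfoGainRule p q V →
        ∀ R : ℝ, R < FeedbackScheme.capacity p →
          Tendsto (fun n : ℕ =>
            FeedbackScheme.errorProb p q V (FeedbackScheme.numMessages n R) n) atTop (𝓝 0)) := by
  refine ⟨fun q hq hq1 => ⟨FeedbackScheme.exists_isMaxInfoGainRule hq p, fun V hV => ?_⟩, ?_⟩
  · have hΨ := FeedbackScheme.Psi_lt_one hp hred hq hq1 hV
    exact ⟨hΨ, fun R hR => ⟨FeedbackScheme.tendsto_errorProb hp hq hV hΨ hR,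
      iSup₂_le fun ρ hρ =>
        FeedbackScheme.sub_log_max_le_errorExponent hp hq hV (ne_top_of_lt hΨ) R (le_of_lt hρ)⟩⟩
  · obtain ⟨q, hq, hcap⟩ := FeedbackScheme.exists_mutualInfo_eq_capacity hp
    refine ⟨q, hq, hcap, FeedbackScheme.exists_isMaxInfoGainRule hq p, fun V hV R hR => ?_⟩
    by_cases hq1 : ∀ x, q x ≠ 1
    · exact FeedbackScheme.tendsto_errorProb hp hq hV
        (FeedbackScheme.Psi_lt_one hp hred hq hq1 hV) (hcap ▸ hR)
    -- A capacity-achieving point mass forces `C = 0`, so `R < 0`: there is a single message and no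
    -- error.
    · push Not at hq1
      obtain ⟨x, hx⟩ := hq1
      rw [← hcap, FeedbackScheme.mutualInfo_of_eq_one hq hx] at hR
      simp only [FeedbackScheme.numMessages_of_nonpos hR.le, FeedbackScheme.errorProb_one]
      exact tendsto_const_nhds
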